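/- **Conventions.** Let $M$ be a first-order structure. A *small extension* of $M$ is a proper elementary extension $N\succ M$ such that for every $a\in N$ and every finite $A\subset M$ the type $\mathrm{tp}(a/A)$ is realized in $M$. A *maximal small extension* of $M$ is a small extension $N$ of $M$ such that $M$ does not have small extensions of arbitrarily large cardinality, every small extension of $M$ has cardinality at most $|N|$, and no proper elementary extension of $N$ is a small extension of $M$. A linearly ordered structure is *o-minimal* if every subset of it that is definable with parameters is a finite union of points and open intervals with endpoints in the structure or $\pm\infty$. For cardinals, $\beta^{<\lambda}=\sup_{\kappa<\lambda}\beta^{\kappa}$, and $\mathrm{Ded}(\alpha)$ is the supremum of $|\bar P|$ over all linear orders $P$ with $|P|\le\alpha$, where $\bar P$ is the Dedekind completion of $P$. For a divisible ordered abelian group $G$, a dense divisible subgroup $Q$ of $G$ and an infinite cardinal $\lambda$, let $G^{\lambda}$ carry componentwise addition and the lexicographic order, let $G^{<\lambda}\subseteq G^\lambda$ be the ordered subgroup of all sequences whose components are $0$ from some index below $\lambda$ on, and let $Q^{<\lambda}$ be the set of those elements of $G^{<\lambda}$ all of whose components lie in $Q$. Write $M(G,Q,\lambda)$ for $G^{<\lambda}$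 as a structure in the language of ordered groups with an additional constant for each element of $Q^{<\lambda}$. **Proposition.** Let $\alpha$ be an infinite cardinal. 1. There are an infinite cardinal $\lambda$, a divisible ordered abelian group $G$ and a dense divisible subgroup $Q$ of $G$ such that $M=M(G,Q,\lambda)$ is o-minimal, $|M|=\alpha$, and $M$ has a maximal small extension $N$ (so $M$ has small extensions, but no arbitrarily large ones). If $\alpha=\aleph_0$, one has moreover $|N|=2^{\aleph_0}=\mathrm{Ded}(\aleph_0)$, so that the largest possible value $\mathrm{Ded}(|M|)$ is attained. 2. If $\alpha=\beta^{<\lambda}$ for some cardinal $\beta$ and some infinite cardinal $\lambda$, then there are a divisible ordered abelian group $G$ and a dense divisible subgroup $Q$ of $G$ such that $M=M(G,Q,\lambda)$ (with this $\lambda$) is o-minimal, $|M|=\alpha$, and $M$ has a maximal small extension of cardinality $\beta^{\lambda}$. In this situation $\beta^{\lambda}\le\mathrm{Ded}(\alpha)$, and $\beta^\lambda=\mathrm{Ded}(\alpha)$ whenever $2^\alpha\le\beta^\lambda$, in particular whenever $\lambda=\alpha$. -/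

import Mathlib

open FirstOrder Cardinal

universe u v w₁ w₂ w₃ w₄

/-! ### o-minimality -/

/-- The open intervals of a linear order, with endpoints in the order or `±∞`. -/
inductive IsOpenInterval {M : Type w₃} [LinearOrder M] : Set M → Prop
  | univ : IsOpenInterval Set.univ
  | ioi (a : M) : IsOpenInterval (Set.Ioi a)
  | iio (b : M) : IsOpenInterval (Set.Iio b)
  | ioo (a b : M) : IsOpenInterval (Set.Ioo a b)

/-- `M` is o-minimal: every subset of `M` that is definable with parameters from `M` is a finite
union of points and open intervals. -/
def OMinimal (L : FirstOrder.Language.{w₁, w₂}) [L.IsOrdered] (M : Type w₃) [LinearOrder M]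
    [L.Structure M] [L.OrderedStructure M] : Prop :=
  ∀ S : Set M, (Set.univ : Set M).Definable₁ L S →
    ∃ F : Set (Set M), F.Finite ∧ (∀ J ∈ F, (∃ a, J = {a}) ∨ IsOpenInterval J) ∧ S = ⋃₀ F

/-! ### Small extensions -/

section Small

variable {L : FirstOrder.Language.{w₁, w₂}} {M : Type w₃} {N : Type w₄} [L.Structure M] [L.Structure N]

/-- The type of `a` over a family `p` of parameters: the set of formulas `φ(x, p)` true of `a`. -/
def tpOver {A : Type*} (p : A → N) (a : N) : Set (L.Formula (A ⊕ Unit)) :=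
  {φ | φ.Realize (Sum.elim p fun _ => a)}

/-- An elementary embedding `f : M → N` makes `N` a small extension of `M` if it is proper and,
for all `a ∈ N` and finite `A ⊆ M`, the type of `a` over `A` is realized in `M`. -/
def IsSmallExtension (f : M ↪ₑ[L] N) : Prop :=
  ¬ Function.Surjective f ∧
    ∀ (a : N) (A : Set M), A.Finite →
      ∃ m : M, tpOver (L := L) (fun x : A => (x : M)) m = tpOver (L := L) (fun x : A => f x) a

end Small

/-- `M` has arbitrarily large small extensions. The universe parameter `v` only serves to let
extensions in all universes above that of `M` be considered. -/
def HasUnboundedSmallExtensions (L : FirstOrder.Language.{w₁, w₂}) (M : Type u) [L.Structure M] : Prop :=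
  ∀ κ : Cardinal.{max u v}, ∃ (N : Type (max u v)) (_ : L.Structure N) (f : M ↪ₑ[L] N),
    IsSmallExtension f ∧ κ ≤ #N

/-- `N` is a maximal small extension of `M` (via `f`): it is a small extension, `M` does not have
arbitrarily large small extensions, `N` has the greatest cardinality among all small extensions
of `M`, and no proper elementary extension of `N` is still a small extension of `M`. -/
def IsMaximalSmallExtension {L : FirstOrder.Language.{w₁, w₂}} {M N : Type u} [L.Structure M] [L.Structure N]
    (f : M ↪ₑ[L] N) : Prop :=
  IsSmallExtension f ∧
    ¬ HasUnboundedSmallExtensions.{u, v} L M ∧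
    (∀ (N' : Type (max u v)) [L.Structure N'] (f' : M ↪ₑ[L] N'),
      IsSmallExtension f' → #N' ≤ Cardinal.lift.{v} #N) ∧
    (∀ (N' : Type (max u v)) [L.Structure N'] (g : N ↪ₑ[L] N'),
      IsSmallExtension (g.comp f) → Function.Surjective g)

/-! ### Ordered groups as first-order structures -/

/-- Function symbols of the language of ordered groups. -/
inductive OrdGroupFunc : ℕ → Type
  | zero : OrdGroupFunc 0
  | neg : OrdGroupFunc 1
  | add : OrdGroupFunc 2

/-- The language `{0, -, +, ≤}` of ordered groups. -/
def ordGroupLang : FirstOrder.Language.{0, 0} := ⟨OrdGroupFunc, FirstOrder.Language.orderRel⟩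

instance : ordGroupLang.IsOrdered := ⟨FirstOrder.Language.orderRel.le⟩

instance ordGroupStructure (M : Type w₃) [AddCommGroup M] [LE M] : ordGroupLang.Structure M where
  funMap
    | OrdGroupFunc.zero, _ => 0
    | OrdGroupFunc.neg, x => -x 0
    | OrdGroupFunc.add, x => x 0 + x 1
  RelMap
    | FirstOrder.Language.orderRel.le, x => x 0 ≤ x 1

instance (M : Type w₃) [AddCommGroup M] [LE M] : ordGroupLang.OrderedStructure M where
  relMap_leSymb := fun _ => Iff.rfl

/-! ### The groups `G^{<λ}` -/

section Power

variable (lam : Cardinal.{u}) (G : Type u) [AddCommGroup G] [LinearOrder G] [IsOrderedAddMonoid G]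

/-- `G^λ` with componentwise addition and the lexicographic order, indexed by the ordinals
below (the initial ordinal of) `λ`. -/
abbrev FullPower : Type u := Lex (lam.ord.ToType → G)

/-- `G^{<λ}`, for an infinite cardinal `λ`: the sequences of length less than `λ`, regarded as the
elements of `G^λ` all of whose components from some index on are `0`. -/
def boundedPower (hlam : ℵ₀ ≤ lam) : AddSubgroup (FullPower lam G) where
  carrier := {x | ∃ i, ∀ j, i ≤ j → ofLex x j = 0}
  zero_mem' := by
    have : Nonempty lam.ord.ToType := by
      rw [Ordinal.nonempty_toType_iff]
      intro h
      rw [Cardinal.ord_eq_zero] at h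
      exact absurd (h ▸ hlam) (not_le.2 aleph0_pos)
    exact ⟨Classical.arbitrary _, fun _ _ => rfl⟩
  add_mem' := by
    rintro x y ⟨i, hi⟩ ⟨k, hk⟩
    refine ⟨max i k, fun j hj => ?_⟩
    have h₁ := hi j ((le_max_left _ _).trans hj)
    have h₂ := hk j ((le_max_right _ _).trans hj)
    change ofLex x j + ofLex y j = 0
    rw [h₁, h₂, add_zero]
  neg_mem' := by
    rintro x ⟨i, hi⟩
    refine ⟨i, fun j hj => ?_⟩
    change - ofLex x j = 0
    rw [hi j hj, neg_zero]

variable {G}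

/-- `Q^{<λ}` as a subset of `G^{<λ}`. -/
def boundedPowerConsts (hlam : ℵ₀ ≤ lam) (Q : AddSubgroup G) : Set (boundedPower lam G hlam) :=
  {x | ∀ i, ofLex (x : FullPower lam G) i ∈ Q}

/-- The language of ordered groups with a constant for each element of `Q^{<λ}`; the structure
on `G^{<λ}` interprets each of these constants as itself. -/
abbrev constLang (hlam : ℵ₀ ≤ lam) (Q : AddSubgroup G) : FirstOrder.Language.{u, 0} :=
  ordGroupLang[[boundedPowerConsts lam hlam Q]]

instance (hlam : ℵ₀ ≤ lam) (Q : AddSubgroup G) : (constLang lam hlam Q).IsOrdered :=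
  ⟨Sum.inl FirstOrder.Language.orderRel.le⟩

instance (hlam : ℵ₀ ≤ lam) (Q : AddSubgroup G) :
    (constLang lam hlam Q).OrderedStructure (boundedPower lam G hlam) where
  relMap_leSymb := fun _ => Iff.rfl

end Power

/-- `G` is a divisible group and `Q` a divisible subgroup that is dense in `G`. -/
def IsDenseDivisible {G : Type u} [AddCommGroup G] [LinearOrder G] (Q : AddSubgroup G) : Prop :=
  (∀ n : ℕ, n ≠ 0 → ∀ g : G, ∃ h : G, n • h = g) ∧
    (∀ n : ℕ, n ≠ 0 → ∀ q ∈ Q, ∃ r ∈ Q, n • r = q) ∧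
    ∀ a b : G, a < b → ∃ q ∈ Q, a < q ∧ q < b

/-! ### Dedekind numbers -/

/-- `Ded α`, the supremum of the cardinalities of the (Dedekind) completions of linear orders of
cardinality at most `α`. -/
noncomputable def Ded (α : Cardinal.{u}) : Cardinal.{u} :=
  sSup {c | ∃ (P : Type u) (_ : LinearOrder P), #P ≤ α ∧ c = #(DedekindCut P)}

/-- The supremum that defines `Ded α` is over a bounded set. -/
theorem bddAbove_ded (α : Cardinal.{u}) :
    BddAbove {c : Cardinal.{u} |
      ∃ (P : Type u) (_ : LinearOrder P), #P ≤ α ∧ c = #(DedekindCut P)} := by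
  refine ⟨2 ^ α, ?_⟩
  rintro c ⟨P, _, hP, rfl⟩
  calc #(DedekindCut P) ≤ #(Set P) :=
        mk_le_of_injective (f := fun A : DedekindCut P => A.left) fun _ _ h => DedekindCut.ext h
    _ = 2 ^ #P := mk_set
    _ ≤ 2 ^ α := power_le_power_left two_ne_zero hP

/-! A nontrivial divisible ordered abelian group eliminates quantifiers: whether a tuple satisfies a
formula depends only on the signs of finitely many integral linear forms
(`exists_forms_of_boundedFormula`). This gives o-minimality and turns questions about elementary
embeddings and types into questions about signs.

Take `G = Q ⊕ H` with `Q` dense and `|H| = |G|`, for instance finitely supported sequences, where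
`Q` is the kernel of the sum of components. Let `N` consist of the sequences in `G^λ` that are
eventually in `H`.

`N` is small. Finitely many parameters from `G^{<λ}` vanish from some index `i` on. If `a` in `N` is
not in `G^{<λ}`, it has a nonzero component at some `j ≥ i` that lies in `H`, hence not in `Q`. A
form `n • a + c` with `n ≠ 0` and `c` built from parameters and constants then has a nonzero `j`-th
component, so its sign is visible up to `j`, and truncating `a` at `j` preserves the type
(`exists_same_sign`).

`N` is as large as possible. An element of any small extension has the cut of some element of
`G^{<λ}` over the constants `Q^{<λ}`. Since `Q` is dense, these cuts yield a sequence in `G^λ` by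
transfinite recursion (`exists_represents`), and the sequence determines the element
(`Represents.eq`). So small extensions have size at most `|G|^λ = |H|^λ ≤ |N|`. If a small extension
contains `N`, subtracting the `H`-parts of the components leaves an element with components in `Q`.
Such an element lies in `G^{<λ}` (`Represents.mem_range`), so the extension is no larger than `N`.

For the cardinals, take `|G| = max β ℵ₀`. As `G^{<λ}` is order-dense in `G^λ`, the power `β^λ` is at
most `Ded`, which is at most `2^α`. The first part is the case `β = α`, `λ = ℵ₀`. -/

open FirstOrder.Language

set_option linter.unusedSectionVars false

/-! ### Signs in ordered groups -/

section Sign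

variable {A : Type*} [AddCommGroup A] [LinearOrder A] [IsOrderedAddMonoid A]

theorem sign_zsmul_eq (n : ℤ) (x : A) :
    SignType.sign (n • x) = SignType.sign n * SignType.sign x := by
  have key : ∀ m : ℤ, 0 < m → ∀ y : A, SignType.sign (m • y) = SignType.sign y := by
    intro m hm y
    rcases lt_trichotomy y 0 with h | h | h
    · rw [sign_neg h, sign_neg]
      have := zsmul_pos (neg_pos.2 h) hm
      rwa [smul_neg, neg_pos] at this
    · simp [h]
    · rw [sign_pos h, sign_pos (zsmul_pos h hm)]
  rcases lt_trichotomy n 0 with h | h | h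
  · have := key (-n) (by omega) x
    rw [neg_smul, Left.sign_neg] at this
    rw [sign_neg h, ← this]
    simp
  · simp [h]
  · rw [key n h, sign_pos h, one_mul]

theorem sign_sub_eq_sign_sub_iff {B : Type*} [AddCommGroup B] [LinearOrder B]
    [IsOrderedAddMonoid B] (a b : A) (c d : B) :
    SignType.sign (a - b) = SignType.sign (c - d) ↔ cmp a b = cmp c d := by
  rcases lt_trichotomy a b with h | h | h <;> rcases lt_trichotomy c d with h' | h' | h' <;>
    simp [h, h', sign_neg, sign_pos, (cmp_eq_lt_iff _ _).2,
      (cmp_eq_gt_iff _ _).2]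

end Sign

/-! ### Quantifier elimination for divisible ordered abelian groups -/

section Elimination

/-- Every element is divisible by every nonzero natural number. -/
def IsDivisible (A : Type*) [AddMonoid A] : Prop :=
  ∀ n : ℕ, n ≠ 0 → ∀ g : A, ∃ h : A, n • h = g

theorem IsDivisible.exists_zsmul {A : Type*} [AddCommGroup A] (h : IsDivisible A) {n : ℤ}
    (hn : n ≠ 0) (g : A) : ∃ x : A, n • x = g := by
  obtain ⟨x, hx⟩ := h n.natAbs (by simpa using hn) g
  rcases Int.natAbs_eq n with hn' | hn'
  · exact ⟨x, by rw [hn', natCast_zsmul, hx]⟩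
  · exact ⟨-x, by rw [hn', neg_smul, smul_neg, neg_neg, natCast_zsmul, hx]⟩

theorem IsDivisible.denselyOrdered {A : Type*} [AddCommGroup A] [LinearOrder A]
    [IsOrderedAddMonoid A] (h : IsDivisible A) : DenselyOrdered A := by
  refine ⟨fun a b hab => ?_⟩
  obtain ⟨x, hx⟩ := h 2 two_ne_zero (a + b)
  rw [two_nsmul] at hx
  refine ⟨x, ?_, ?_⟩
  · by_contra! hc
    exact absurd hx (ne_of_lt ((add_le_add hc hc).trans_lt (by gcongr)))
  · by_contra! hc
    exact absurd hx (ne_of_gt ((show a + b < b + b by gcongr).trans_le (add_le_add hc hc)))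

open Finsupp

section SameSigns

variable {A B : Type*} [AddCommGroup A] [LinearOrder A] [AddCommGroup B] [LinearOrder B]

/-- The tuples `v` and `w` give the same signs to the integral linear forms in `F`. -/
def SameSigns {ι : Type*} (F : Set (ι →₀ ℤ)) (v : ι → A) (w : ι → B) : Prop :=
  ∀ f ∈ F, SignType.sign (linearCombination ℤ v f) = SignType.sign (linearCombination ℤ w f)

theorem SameSigns.symm {ι : Type*} {F : Set (ι →₀ ℤ)} {v : ι → A} {w : ι → B}
    (h : SameSigns F v w) : SameSigns F w v := fun f hf => (h f hf).symm

theorem SameSigns.mono {ι : Type*} {F F' : Set (ι →₀ ℤ)} {v : ι → A} {w : ι → B}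
    (h : SameSigns F v w) (hF : F' ⊆ F) : SameSigns F' v w := fun f hf => h f (hF hf)

end SameSigns

variable {A B : Type*} [AddCommGroup A] [LinearOrder A] [IsOrderedAddMonoid A]
  [AddCommGroup B] [LinearOrder B] [IsOrderedAddMonoid B]

open Classical in
/-- The forms needed to control the signs of the forms `p.1 • x + p.2` in one more variable. -/
noncomputable def eliminate {ι : Type*} (P : Finset (ℤ × (ι →₀ ℤ))) : Finset (ι →₀ ℤ) :=
  P.image Prod.snd ∪ (P ×ˢ P).image fun pq => pq.1.1 • pq.2.2 - pq.2.1 • pq.1.2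

/-- One step of back-and-forth. A form with nonzero leading coefficient changes sign at its root, so
only the position of `a` among finitely many roots matters. The forms in `eliminate P` make the
roots in `B` ordered as those in `A`, and density without endpoints supplies `b`. -/
theorem SameSigns.exists_extension (hA : IsDivisible A) (hB : IsDivisible B) [Nontrivial B]
    {ι : Type*} (P : Finset (ℤ × (ι →₀ ℤ))) {v : ι → A} {w : ι → B}
    (h : SameSigns (eliminate P : Set (ι →₀ ℤ)) v w) (a : A) :
    ∃ b : B, ∀ p ∈ P, SignType.sign (p.1 • a + linearCombination ℤ v p.2) =
      SignType.sign (p.1 • b + linearCombination ℤ w p.2) := by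
  classical
  have := hB.denselyOrdered
  -- `c p` is the root of the form `p`; the value `0` for `p.1 = 0` is a dummy.
  have hc : ∀ p : ℤ × (ι →₀ ℤ), ∃ c : A, p.1 ≠ 0 → p.1 • c = - linearCombination ℤ v p.2 := by
    intro p
    by_cases hp : p.1 = 0
    · exact ⟨0, fun h => absurd hp h⟩
    · obtain ⟨x, hx⟩ := hA.exists_zsmul hp (- linearCombination ℤ v p.2)
      exact ⟨x, fun _ => hx⟩
  have hd : ∀ p : ℤ × (ι →₀ ℤ), ∃ c : B, p.1 ≠ 0 → p.1 • c = - linearCombination ℤ w p.2 := by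
    intro p
    by_cases hp : p.1 = 0
    · exact ⟨0, fun h => absurd hp h⟩
    · obtain ⟨x, hx⟩ := hB.exists_zsmul hp (- linearCombination ℤ w p.2)
      exact ⟨x, fun _ => hx⟩
  choose c hc using hc
  choose d hd using hd
  -- Matching roots form a finite partial isomorphism: the cross form `p.1 • q.2 - q.1 • p.2`
  -- evaluates to `p.1 * q.1` times the difference of the roots.
  let f : Order.PartialIso A B := ⟨(P.filter fun p => p.1 ≠ 0).image fun p => (c p, d p), by
    simp only [Finset.mem_image, Finset.mem_filter]
    rintro _ ⟨p, ⟨hp, hp0⟩, rfl⟩ _ ⟨q, ⟨hq, hq0⟩, rfl⟩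
    rw [← sign_sub_eq_sign_sub_iff]
    have hpq := h (p.1 • q.2 - q.1 • p.2) (by
      simp only [eliminate, Finset.coe_union, Set.mem_union]
      right
      simp only [Finset.coe_image, Set.mem_image]
      exact ⟨(p, q), by simp [hp, hq], rfl⟩)
    have e1 : linearCombination ℤ v (p.1 • q.2 - q.1 • p.2) = (p.1 * q.1) • (c p - c q) := by
      rw [map_sub, map_smul, map_smul, smul_sub, mul_smul, mul_comm, mul_smul,
        smul_comm p.1 q.1 (c p), smul_comm q.1 p.1 (c q), hc p hp0, hc q hq0]
      rw [smul_neg, smul_neg]; abel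
    have e2 : linearCombination ℤ w (p.1 • q.2 - q.1 • p.2) = (p.1 * q.1) • (d p - d q) := by
      rw [map_sub, map_smul, map_smul, smul_sub, mul_smul, mul_comm, mul_smul,
        smul_comm p.1 q.1 (d p), smul_comm q.1 p.1 (d q), hd p hp0, hd q hq0]
      rw [smul_neg, smul_neg]; abel
    rw [e1, e2, sign_zsmul_eq, sign_zsmul_eq] at hpq
    refine mul_left_cancel₀ ?_ hpq
    rw [ne_eq, sign_eq_zero_iff]
    exact mul_ne_zero hp0 hq0⟩
  obtain ⟨b, hb⟩ := Order.PartialIso.exists_across f a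
  refine ⟨b, fun p hp => ?_⟩
  by_cases hp0 : p.1 = 0
  · simp only [hp0, zero_smul, zero_add]
    exact h _ (by simp only [eliminate, Finset.coe_union, Set.mem_union]
                  exact Or.inl (Finset.mem_coe.2 (Finset.mem_image_of_mem _ hp)))
  · have hb' := hb (c p, d p) (Finset.mem_image_of_mem _ (by simp [hp, hp0]))
    have e1 : p.1 • a + linearCombination ℤ v p.2 = (-p.1) • (c p - a) := by
      rw [smul_sub, neg_smul, neg_smul, hc p hp0]; abel
    have e2 : p.1 • b + linearCombination ℤ w p.2 = (-p.1) • (d p - b) := by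
      rw [smul_sub, neg_smul, neg_smul, hd p hp0]; abel
    rw [e1, e2, sign_zsmul_eq, sign_zsmul_eq]
    congr 1
    exact (sign_sub_eq_sign_sub_iff _ _ _ _).2 hb'

/-- The decomposition of a linear form as a multiple of the last variable plus a form in the
other variables. -/
theorem exists_last_variable {ι : Type*} {n : ℕ} (f : (ι ⊕ Fin (n + 1)) →₀ ℤ) :
    ∃ p : ℤ × ((ι ⊕ Fin n) →₀ ℤ), ∀ (A : Type u) [AddCommGroup A] (v : ι → A) (xs : Fin n → A)
      (a : A), linearCombination ℤ (Sum.elim v (Fin.snoc xs a : Fin (n + 1) → A)) f =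
        p.1 • a + linearCombination ℤ (Sum.elim v xs) p.2 := by
  induction f using Finsupp.induction_linear with
  | zero => exact ⟨0, by intros; simp⟩
  | add f g hf hg =>
    obtain ⟨p, hp⟩ := hf
    obtain ⟨q, hq⟩ := hg
    refine ⟨p + q, fun A _ v xs a => ?_⟩
    rw [map_add, hp, hq, Prod.fst_add, Prod.snd_add, map_add, add_smul]
    abel
  | single i m =>
    rcases i with i | i
    · exact ⟨(0, single (Sum.inl i) m), by intros; simp⟩
    · refine Fin.lastCases ?_ (fun i => ?_) i
      · exact ⟨(m, 0), by intros; simp⟩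
      · exact ⟨(0, single (Sum.inr i) m), by intros; simp⟩

/-- The form does not depend on the group, so the same form can be evaluated in both groups being
compared. -/
theorem exists_linear_form_of_term {ι : Type*} (t : ordGroupLang.Term ι) :
    ∃ f : ι →₀ ℤ, ∀ (A : Type u) [AddCommGroup A] [LE A] (v : ι → A),
      t.realize v = linearCombination ℤ v f := by
  induction t with
  | var i => exact ⟨single i 1, by intros; simp⟩
  | func F ts ih =>
    choose f hf using ih
    cases F with
    | zero => exact ⟨0, by intros; simp only [map_zero]; rfl⟩
    | neg =>
      refine ⟨- f 0, fun A _ _ v => ?_⟩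
      rw [map_neg, ← hf 0 A v]; rfl
    | add =>
      refine ⟨f 0 + f 1, fun A _ _ v => ?_⟩
      rw [map_add, ← hf 0 A v, ← hf 1 A v]; rfl

/-- Quantifier elimination for nontrivial divisible ordered abelian groups: the truth of a formula
is determined by the signs of finitely many integral linear forms. -/
theorem exists_forms_of_boundedFormula {A B : Type u} [AddCommGroup A] [LinearOrder A]
    [IsOrderedAddMonoid A] [AddCommGroup B] [LinearOrder B] [IsOrderedAddMonoid B]
    [Nontrivial A] [Nontrivial B] (hA : IsDivisible A) (hB : IsDivisible B) {ι : Type*} {n : ℕ}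
    (φ : ordGroupLang.BoundedFormula ι n) :
    ∃ F : Finset ((ι ⊕ Fin n) →₀ ℤ), ∀ (v : ι → A) (xs : Fin n → A) (w : ι → B) (ys : Fin n → B),
      SameSigns (F : Set ((ι ⊕ Fin n) →₀ ℤ)) (Sum.elim v xs) (Sum.elim w ys) →
        (φ.Realize v xs ↔ φ.Realize w ys) := by
  classical
  induction φ with
  | falsum => exact ⟨∅, fun _ _ _ _ _ => Iff.rfl⟩
  | equal t₁ t₂ =>
    obtain ⟨f, hf⟩ := exists_linear_form_of_term.{u} t₁
    obtain ⟨g, hg⟩ := exists_linear_form_of_term.{u} t₂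
    refine ⟨{f - g}, fun v xs w ys h => ?_⟩
    have := h (f - g) (by simp)
    rw [LinearMap.map_sub, LinearMap.map_sub, ← hf, ← hf, ← hg, ← hg,
      sign_sub_eq_sign_sub_iff] at this
    change _ = _ ↔ _ = _
    rw [← cmp_eq_eq_iff, this, cmp_eq_eq_iff]
  | rel R ts =>
    cases R with
    | le =>
      obtain ⟨f, hf⟩ := exists_linear_form_of_term.{u} (ts 0)
      obtain ⟨g, hg⟩ := exists_linear_form_of_term.{u} (ts 1)
      refine ⟨{f - g}, fun v xs w ys h => ?_⟩
      have := h (f - g) (by simp)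
      rw [LinearMap.map_sub, LinearMap.map_sub, ← hf, ← hf, ← hg, ← hg,
      sign_sub_eq_sign_sub_iff] at this
      change _ ≤ _ ↔ _ ≤ _
      rw [← not_lt, ← not_lt, ← cmp_eq_gt_iff, ← cmp_eq_gt_iff, this]
  | imp φ ψ ihφ ihψ =>
    obtain ⟨F, hF⟩ := ihφ
    obtain ⟨F', hF'⟩ := ihψ
    refine ⟨F ∪ F', fun v xs w ys h => ?_⟩
    rw [Finset.coe_union] at h
    rw [BoundedFormula.realize_imp, BoundedFormula.realize_imp,
      hF v xs w ys (h.mono Set.subset_union_left), hF' v xs w ys (h.mono Set.subset_union_right)]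
  | @all n φ ih =>
    obtain ⟨F, hF⟩ := ih
    choose p hp using fun f : (ι ⊕ Fin (n + 1)) →₀ ℤ => exists_last_variable.{u} f
    refine ⟨eliminate (F.image p), fun v xs w ys h => ?_⟩
    rw [BoundedFormula.realize_all, BoundedFormula.realize_all]
    constructor
    · intro H b
      obtain ⟨a, ha⟩ := h.symm.exists_extension hB hA (F.image p) b
      refine (hF v (Fin.snoc xs a) w (Fin.snoc ys b) fun f hf => ?_).1 (H a)
      rw [hp, hp]
      exact (ha (p f) (Finset.mem_image_of_mem _ hf)).symm
    · intro H a
      obtain ⟨b, hb⟩ := h.exists_extension hA hB (F.image p) a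
      refine (hF v (Fin.snoc xs a) w (Fin.snoc ys b) fun f hf => ?_).2 (H b)
      rw [hp, hp]
      exact hb (p f) (Finset.mem_image_of_mem _ hf)

/-- A variant for formulas without bound variables. -/
theorem exists_forms_of_formula {A B : Type u} [AddCommGroup A] [LinearOrder A]
    [IsOrderedAddMonoid A] [AddCommGroup B] [LinearOrder B] [IsOrderedAddMonoid B]
    [Nontrivial A] [Nontrivial B] (hA : IsDivisible A) (hB : IsDivisible B) {ι : Type*}
    (φ : ordGroupLang.Formula ι) :
    ∃ F : Finset (ι →₀ ℤ), ∀ (v : ι → A) (w : ι → B),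
      SameSigns (F : Set (ι →₀ ℤ)) v w → (φ.Realize v ↔ φ.Realize w) := by
  classical
  obtain ⟨F, hF⟩ := exists_forms_of_boundedFormula hA hB φ
  refine ⟨F.image (Finsupp.mapDomain (Sum.elim id Fin.elim0)), fun v w h =>
    hF v default w default fun f hf => ?_⟩
  have := h _ (Finset.mem_coe.2 (Finset.mem_image_of_mem _ hf))
  rw [linearCombination_mapDomain, linearCombination_mapDomain] at this
  convert! this using 4
  · ext (i | i)
    · rfl
    · exact i.elim0
  · ext (i | i)
    · rfl
    · exact i.elim0

/-- Tuples that give the same signs to all linear forms, constants included, satisfy the same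
formulas in the language with constants. -/
theorem realize_iff_of_sameSigns {A B : Type u} [AddCommGroup A] [LinearOrder A]
    [IsOrderedAddMonoid A] [AddCommGroup B] [LinearOrder B] [IsOrderedAddMonoid B]
    [Nontrivial A] [Nontrivial B] (hA : IsDivisible A) (hB : IsDivisible B) {C ι : Type*}
    [(Language.constantsOn C).Structure A] [(Language.constantsOn C).Structure B]
    {v : ι → A} {w : ι → B}
    (h : SameSigns Set.univ
      (Sum.elim (fun c : C => ((ordGroupLang.con c : ordGroupLang[[C]].Constants) : A)) v)
      (Sum.elim (fun c : C => ((ordGroupLang.con c : ordGroupLang[[C]].Constants) : B)) w))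
    (φ : ordGroupLang[[C]].Formula ι) : φ.Realize v ↔ φ.Realize w := by
  obtain ⟨F, hF⟩ := exists_forms_of_formula hA hB
    (BoundedFormula.constantsVarsEquiv φ : ordGroupLang.Formula (C ⊕ ι))
  have := hF _ _ (h.mono (Set.subset_univ _))
  unfold Formula.Realize at this ⊢
  rwa [BoundedFormula.realize_constantsVarsEquiv, BoundedFormula.realize_constantsVarsEquiv] at this

end Elimination

/-! ### O-minimality -/

section OMinimality

/-- The intersection of an open interval with a set `{y | cmp y p = o}` is a point or an
open interval. -/
theorem IsOpenInterval.inter_cmp {A : Type*} [LinearOrder A] {J : Set A} (hJ : IsOpenInterval J)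
    (p : A) (o : Ordering) :
    (∃ a, J ∩ {y | cmp y p = o} = {a}) ∨ IsOpenInterval (J ∩ {y | cmp y p = o}) := by
  -- The empty set counts as the interval from `p` to `p`.
  have empty : IsOpenInterval (∅ : Set A) := Set.Ioo_self p ▸ .ioo p p
  cases o with
  | eq =>
    simp only [cmp_eq_eq_iff, Set.ofPred_eq_eq_singleton]
    by_cases hp : p ∈ J
    · exact Or.inl ⟨p, Set.inter_eq_right.2 (Set.singleton_subset_iff.2 hp)⟩
    · rw [Set.inter_singleton_eq_empty.2 hp]
      exact Or.inr empty
  | lt =>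
    have e : {y | cmp y p = .lt} = Set.Iio p := by ext; simp [cmp_eq_lt_iff]
    rw [e]
    right
    cases hJ with
    | univ => rw [Set.univ_inter]; exact .iio p
    | ioi a => rw [Set.Ioi_inter_Iio]; exact .ioo a p
    | iio b => rw [Set.Iio_inter_Iio]; exact .iio _
    | ioo a b =>
      rw [← Set.Ioi_inter_Iio, Set.inter_assoc, Set.Iio_inter_Iio, Set.Ioi_inter_Iio]
      exact .ioo _ _
  | gt =>
    have e : {y | cmp y p = .gt} = Set.Ioi p := by ext; simp [cmp_eq_gt_iff]
    rw [e]
    right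
    cases hJ with
    | univ => rw [Set.univ_inter]; exact .ioi p
    | ioi a => rw [Set.Ioi_inter_Ioi]; exact .ioi _
    | iio b => rw [Set.inter_comm, Set.Ioi_inter_Iio]; exact .ioo p b
    | ioo a b =>
      rw [← Set.Ioi_inter_Iio, Set.inter_right_comm, Set.Ioi_inter_Ioi, Set.Ioi_inter_Iio]
      exact .ioo _ _

theorem setOf_cmp_eq_point_or_isOpenInterval {A : Type*} [LinearOrder A] [Nonempty A]
    (P : Finset A) (σ : A → Ordering) :
    (∃ a, {y | ∀ p ∈ P, cmp y p = σ p} = {a}) ∨ IsOpenInterval {y | ∀ p ∈ P, cmp y p = σ p} := by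
  classical
  induction P using Finset.induction_on with
  | empty => right; simpa using IsOpenInterval.univ
  | insert p P _ ih =>
    have e : {y | ∀ q ∈ insert p P, cmp y q = σ q} =
        {y | ∀ q ∈ P, cmp y q = σ q} ∩ {y | cmp y p = σ p} := by
      ext y; simp [and_comm]
    rw [e]
    rcases ih with ⟨a, ha⟩ | ih
    · rw [ha]
      by_cases h : cmp a p = σ p
      · exact Or.inl ⟨a, Set.inter_eq_left.2 (Set.singleton_subset_iff.2 h)⟩
      · rw [Set.singleton_inter_eq_empty.2 (show a ∉ {y | cmp y p = σ p} from h)]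
        exact Or.inr (Set.Ioo_self a ▸ .ioo a a)
    · exact ih.inter_cmp p _

/-- `S` is a union of classes of points with the same position relative to `P`. There are only
finitely many positions, and each class is a point or an interval. -/
theorem exists_finite_union_of_cmp {A : Type*} [LinearOrder A] [Nonempty A] (P : Finset A)
    (S : Set A) (h : ∀ x y, (∀ p ∈ P, cmp y p = cmp x p) → x ∈ S → y ∈ S) :
    ∃ F : Set (Set A), F.Finite ∧ (∀ J ∈ F, (∃ a, J = {a}) ∨ IsOpenInterval J) ∧ S = ⋃₀ F := by
  refine ⟨{J | ∃ x ∈ S, J = {y | ∀ p ∈ P, cmp y p = cmp x p}}, ?_, ?_, ?_⟩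
  · refine (Set.finite_range fun τ : P → Ordering => {y : A | ∀ p : P, cmp y p = τ p}).subset ?_
    rintro _ ⟨x, _, rfl⟩
    exact ⟨fun p => cmp x p, by ext; simp⟩
  · rintro _ ⟨x, _, rfl⟩
    exact setOf_cmp_eq_point_or_isOpenInterval P (cmp x)
  · ext y
    simp only [Set.mem_sUnion, Set.mem_ofPred_eq]
    constructor
    · exact fun hy => ⟨_, ⟨y, hy, rfl⟩, fun _ _ => rfl⟩
    · rintro ⟨_, ⟨x, hx, rfl⟩, hy⟩
      exact h x y hy hx

theorem exists_affine_of_linearCombination {ι κ : Type*} (f : (ι ⊕ κ) →₀ ℤ) :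
    ∃ (n : ℤ) (g : ι →₀ ℤ), ∀ (B : Type u) [AddCommGroup B] (v : ι → B) (x : B),
      Finsupp.linearCombination ℤ (Sum.elim v fun _ => x) f =
        n • x + Finsupp.linearCombination ℤ v g := by
  induction f using Finsupp.induction_linear with
  | zero => exact ⟨0, 0, by intros; simp⟩
  | add f g hf hg =>
    obtain ⟨n, r, hn⟩ := hf
    obtain ⟨m, s, hm⟩ := hg
    refine ⟨n + m, r + s, fun B _ v x => ?_⟩
    rw [map_add, hn, hm, map_add, add_smul]
    abel
  | single i m =>
    rcases i with i | i
    · exact ⟨0, Finsupp.single i m, by intros; simp⟩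
    · exact ⟨m, 0, by intros; simp⟩

/-- Nontrivial divisible ordered abelian groups are o-minimal, also with constants. -/
theorem IsDivisible.oMinimal {A : Type u} [AddCommGroup A] [LinearOrder A] [IsOrderedAddMonoid A]
    [Nontrivial A] (hA : IsDivisible A) {C : Type w₁} [(Language.constantsOn C).Structure A]
    [(ordGroupLang[[C]]).IsOrdered] [(ordGroupLang[[C]]).OrderedStructure A] :
    OMinimal (ordGroupLang[[C]]) A := by
  classical
  intro S hS
  obtain ⟨φ, hφ⟩ := Set.definable_iff_exists_formula_sum.1 hS
  obtain ⟨F, hF⟩ := exists_forms_of_formula hA hA (BoundedFormula.constantsVarsEquiv φ :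
    ordGroupLang.Formula (C ⊕ (Set.univ : Set A) ⊕ Fin 1))
  let c : C → A := fun a => ((ordGroupLang.con a : ordGroupLang[[C]].Constants) : A)
  let u : C ⊕ (Set.univ : Set A) → A := Sum.elim c (↑)
  let w : A → C ⊕ (Set.univ : Set A) ⊕ Fin 1 → A := fun x =>
    Sum.elim c (Sum.elim (↑) fun _ => x)
  have hmem : ∀ x, x ∈ S ↔ Formula.Realize (BoundedFormula.constantsVarsEquiv φ :
      ordGroupLang.Formula (C ⊕ (Set.univ : Set A) ⊕ Fin 1)) (w x) := by
    intro x
    have h₁ : x ∈ S ↔ (fun _ : Fin 1 => x) ∈ {v | φ.Realize (Sum.elim (↑) v)} := by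
      rw [← hφ]; rfl
    refine h₁.trans ?_
    unfold Formula.Realize
    exact BoundedFormula.realize_constantsVarsEquiv.symm
  choose n g hng using fun f : (C ⊕ (Set.univ : Set A)) ⊕ Fin 1 →₀ ℤ =>
    exists_affine_of_linearCombination.{u} f
  let assoc := (Equiv.sumAssoc C (Set.univ : Set A) (Fin 1)).symm
  have heval : ∀ f x, Finsupp.linearCombination ℤ (w x) f =
      n (f.mapDomain assoc) • x + Finsupp.linearCombination ℤ u (g (f.mapDomain assoc)) := by
    intro f x
    rw [← hng, Finsupp.linearCombination_mapDomain]
    congr 2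
    ext (i | i | i) <;> rfl
  have hroot : ∀ f : (C ⊕ (Set.univ : Set A)) ⊕ Fin 1 →₀ ℤ, ∃ r : A,
      n f ≠ 0 → n f • r = - Finsupp.linearCombination ℤ u (g f) := by
    intro f
    by_cases hf : n f = 0
    · exact ⟨0, fun h => absurd hf h⟩
    · obtain ⟨r, hr⟩ := hA.exists_zsmul hf (- Finsupp.linearCombination ℤ u (g f))
      exact ⟨r, fun _ => hr⟩
  choose r hr using hroot
  -- The cut points are the roots of the forms in `F`, since the sign of `n • (x - r)` depends on
  -- `x` only through its position relative to `r`.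
  refine exists_finite_union_of_cmp (F.image fun f => r (f.mapDomain assoc)) S fun x y hxy hx => ?_
  rw [hmem] at hx ⊢
  refine (hF (w x) (w y) fun f hf => ?_).1 hx
  rw [heval, heval]
  by_cases h0 : n (f.mapDomain assoc) = 0
  · simp [h0]
  · have e : ∀ z : A, n (f.mapDomain assoc) • z +
        Finsupp.linearCombination ℤ u (g (f.mapDomain assoc)) =
        n (f.mapDomain assoc) • (z - r (f.mapDomain assoc)) := by
      intro z
      rw [smul_sub, hr _ h0, sub_neg_eq_add]
    rw [e, e, sign_zsmul_eq, sign_zsmul_eq]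
    congr 1
    exact (sign_sub_eq_sign_sub_iff _ _ _ _).2 (hxy _ (Finset.mem_image_of_mem _ hf)).symm

end OMinimality

/-! ### Components and truncations of sequences -/

section Coordinates

variable {lam : Cardinal.{u}} {G : Type u} [AddCommGroup G] [LinearOrder G] [IsOrderedAddMonoid G]

namespace FullPower

/-- The `i`-th coordinate on `G^λ`. -/
def coord (i : lam.ord.ToType) : FullPower lam G →+ G where
  toFun x := ofLex x i
  map_zero' := rfl
  map_add' _ _ := rfl

theorem ext_coord {x y : FullPower lam G} (h : ∀ i, coord i x = coord i y) : x = y :=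
  funext h

theorem lt_iff {x y : FullPower lam G} :
    x < y ↔ ∃ i, (∀ j < i, coord j x = coord j y) ∧ coord i x < coord i y := Iff.rfl

theorem pos_iff {x : FullPower lam G} : 0 < x ↔ ∃ i, (∀ j < i, coord j x = 0) ∧ 0 < coord i x := by
  rw [lt_iff]
  simp only [map_zero, eq_comm]

/-- The leading component of `x` has index at most `j`, where `x` and `y` agree. -/
theorem pos_of_agree {x y : FullPower lam G} {j : lam.ord.ToType}
    (h : ∀ k ≤ j, coord k x = coord k y) (hj : coord j x ≠ 0) (hx : 0 < x) : 0 < y := by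
  rw [pos_iff] at hx ⊢
  obtain ⟨i, hi, hi'⟩ := hx
  have hij : i ≤ j := by
    by_contra! hc
    exact hj (hi j hc)
  exact ⟨i, fun k hk => h k (hk.le.trans hij) ▸ hi k hk, h i hij ▸ hi'⟩

theorem sign_eq_of_agree {x y : FullPower lam G} {j : lam.ord.ToType}
    (h : ∀ k ≤ j, coord k x = coord k y) (hj : coord j x ≠ 0) :
    SignType.sign x = SignType.sign y := by
  rcases lt_trichotomy x 0 with hx | hx | hx
  · have : 0 < -y := pos_of_agree (x := -x) (j := j) (fun k hk => by rw [map_neg, map_neg, h k hk])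
      (by rwa [map_neg, neg_ne_zero]) (neg_pos.2 hx)
    rw [sign_neg hx, sign_neg (neg_pos.1 this)]
  · exact absurd (by rw [hx, map_zero]) hj
  · rw [sign_pos hx, sign_pos (pos_of_agree h hj hx)]

end FullPower

open FullPower

/-- The sequences whose components lie in `H` from some index on. -/
def eventuallyIn (hlam : ℵ₀ ≤ lam) (H : AddSubgroup G) : AddSubgroup (FullPower lam G) where
  carrier := {x | ∃ i, ∀ j, i ≤ j → coord j x ∈ H}
  zero_mem' := by
    obtain ⟨i, hi⟩ := (boundedPower lam G hlam).zero_mem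
    exact ⟨i, fun j hj => by rw [map_zero]; exact H.zero_mem⟩
  add_mem' := by
    rintro x y ⟨i, hi⟩ ⟨k, hk⟩
    refine ⟨max i k, fun j hj => ?_⟩
    rw [map_add]
    exact H.add_mem (hi j ((le_max_left _ _).trans hj)) (hk j ((le_max_right _ _).trans hj))
  neg_mem' := by
    rintro x ⟨i, hi⟩
    refine ⟨i, fun j hj => ?_⟩
    rw [map_neg]
    exact H.neg_mem (hi j hj)

/-- The sequences whose components lie in `Q` from the index `i` on. -/
def fromIn (i : lam.ord.ToType) (Q : AddSubgroup G) : AddSubgroup (FullPower lam G) where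
  carrier := {x | ∀ j, i ≤ j → coord j x ∈ Q}
  zero_mem' := fun j _ => by rw [map_zero]; exact Q.zero_mem
  add_mem' := fun hx hy j hj => by rw [map_add]; exact Q.add_mem (hx j hj) (hy j hj)
  neg_mem' := fun hx j hj => by rw [map_neg]; exact Q.neg_mem (hx j hj)

variable (hlam : ℵ₀ ≤ lam)

theorem boundedPower_le_eventuallyIn (H : AddSubgroup G) :
    boundedPower lam G hlam ≤ eventuallyIn hlam H := by
  rintro x ⟨i, hi⟩
  refine ⟨i, fun j hj => ?_⟩
  rw [show coord j x = 0 from hi j hj]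
  exact H.zero_mem

theorem boundedPower_eq_eventuallyIn_bot :
    boundedPower lam G hlam = eventuallyIn hlam (⊥ : AddSubgroup G) := rfl

/-- The truncation of a sequence, which keeps the components up to the index `i`. -/
noncomputable def trunc (i : lam.ord.ToType) (x : FullPower lam G) : boundedPower lam G hlam :=
  ⟨toLex fun j => if j ≤ i then coord j x else 0, by
    have := Cardinal.noMaxOrder hlam
    obtain ⟨k, hk⟩ := exists_gt i
    exact ⟨k, fun j hj => if_neg (hk.trans_le hj).not_ge⟩⟩

/-- The sequence with the single component `g` at the index `i`. -/
noncomputable def singleAt (i : lam.ord.ToType) : G →+ boundedPower lam G hlam where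
  toFun g := ⟨toLex fun j => if j = i then g else 0, by
    have := Cardinal.noMaxOrder hlam
    obtain ⟨k, hk⟩ := exists_gt i
    exact ⟨k, fun j hj => if_neg (hk.trans_le hj).ne'⟩⟩
  map_zero' := Subtype.ext (funext fun _ => ite_self _)
  map_add' g h := Subtype.ext (ext_coord fun j => by
    rw [AddSubgroup.coe_add, map_add]
    change (if j = i then g + h else 0) = (if j = i then g else 0) + (if j = i then h else 0)
    split_ifs
    · rfl
    · rw [add_zero])

theorem coord_trunc (i j : lam.ord.ToType) (x : FullPower lam G) :
    coord j (trunc hlam i x : FullPower lam G) = if j ≤ i then coord j x else 0 := rfl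

theorem coord_singleAt (i j : lam.ord.ToType) (g : G) :
    coord j (singleAt hlam i g : FullPower lam G) = if j = i then g else 0 := rfl

/-- Division is componentwise. Because `G` is torsion-free, quotients are unique, so those taken in
`G` of elements of `H` already lie in `H`. -/
theorem IsDivisible.eventuallyIn (hG : IsDivisible G) {H : AddSubgroup G}
    (hH : ∀ n : ℕ, n ≠ 0 → ∀ q ∈ H, ∃ r ∈ H, n • r = q) :
    IsDivisible (eventuallyIn hlam H) := by
  rintro n hn ⟨x, i, hi⟩
  choose y hy using fun j => hG n hn (coord j x)
  refine ⟨⟨toLex y, i, fun j hj => ?_⟩, Subtype.ext (funext hy)⟩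
  obtain ⟨r, hr, hr'⟩ := hH n hn _ (hi j hj)
  have : y j = r := nsmul_right_injective hn ((hy j).trans hr'.symm)
  exact (this ▸ hr : y j ∈ H)

theorem IsDivisible.boundedPower (hG : IsDivisible G) : IsDivisible (boundedPower lam G hlam) := by
  rw [boundedPower_eq_eventuallyIn_bot]
  exact hG.eventuallyIn hlam fun n _ q hq => ⟨0, zero_mem _, by
    rw [smul_zero, AddSubgroup.mem_bot.1 hq]⟩

theorem nontrivial_boundedPower [Nontrivial G] : Nontrivial (boundedPower lam G hlam) := by
  obtain ⟨i, -⟩ := (boundedPower lam G hlam).zero_mem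
  obtain ⟨g, hg⟩ := exists_ne (0 : G)
  refine ⟨singleAt hlam i g, 0, fun h => hg ?_⟩
  have := congrArg (fun x : boundedPower lam G hlam => coord i (x : FullPower lam G)) h
  simpa [coord_singleAt] using! this

end Coordinates

theorem sign_map_of_strictMono {A B : Type*} [AddCommGroup A] [LinearOrder A] [AddCommGroup B]
    [LinearOrder B] (g : A →+ B) (hg : StrictMono g) (x : A) :
    SignType.sign (g x) = SignType.sign x := by
  rcases lt_trichotomy x 0 with h | h | h
  · rw [sign_neg h, sign_neg (by simpa using hg h)]
  · subst h
    rw [AddMonoidHom.map_zero, sign_zero, sign_zero]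
  · rw [sign_pos h, sign_pos (by simpa using hg h)]

theorem linearCombination_map_comp {A B ι : Type*} [AddCommGroup A] [AddCommGroup B] (g : A →+ B)
    (v : ι → A) (f : ι →₀ ℤ) :
    Finsupp.linearCombination ℤ (g ∘ v) f = g (Finsupp.linearCombination ℤ v f) :=
  (Finsupp.apply_linearCombination ℤ g.toIntLinearMap v f).symm

theorem sameSigns_comp {A B ι : Type*} [AddCommGroup A] [LinearOrder A] [AddCommGroup B]
    [LinearOrder B] (g : A →+ B) (hg : StrictMono g) (v : ι → A) :
    SameSigns Set.univ v (g ∘ v) := by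
  intro f _
  rw [linearCombination_map_comp, sign_map_of_strictMono g hg]

/-! ### Smallness of the group of sequences eventually in `H` -/

section Extension

open FullPower

variable {lam : Cardinal.{u}} {G : Type u} [AddCommGroup G] [LinearOrder G] [IsOrderedAddMonoid G]
  (hlam : ℵ₀ ≤ lam) (Q H : AddSubgroup G)

/-- The constants for `Q^{<λ}` in the group of sequences that are eventually in `H`. -/
instance : (Language.constantsOn (boundedPowerConsts lam hlam Q)).Structure (eventuallyIn hlam H) :=
  constantsOn.structure fun c => AddSubgroup.inclusion (boundedPower_le_eventuallyIn hlam H) c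

variable {Q H}

theorem strictMono_inclusion {A : Type*} [AddGroup A] [Preorder A] {K K' : AddSubgroup A}
    (h : K ≤ K') : StrictMono (AddSubgroup.inclusion h) := fun _ _ hxy => hxy

/-- The inclusion of `G^{<λ}` in the sequences that are eventually in `H` is elementary. -/
noncomputable def boundedPowerEmbedding [Nontrivial G] (hG : IsDivisible G)
    (hH : ∀ n : ℕ, n ≠ 0 → ∀ q ∈ H, ∃ r ∈ H, n • r = q) :
    boundedPower lam G hlam ↪ₑ[constLang lam hlam Q] eventuallyIn hlam H where
  toFun := AddSubgroup.inclusion (boundedPower_le_eventuallyIn hlam H)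
  map_formula' n φ x := by
    have := nontrivial_boundedPower (G := G) hlam
    have : Nontrivial (eventuallyIn hlam H) :=
      (AddSubgroup.inclusion_injective (boundedPower_le_eventuallyIn hlam H)).nontrivial
    refine (realize_iff_of_sameSigns (hG.boundedPower hlam) (hG.eventuallyIn hlam hH) ?_ φ).symm
    convert! sameSigns_comp _ (strictMono_inclusion (boundedPower_le_eventuallyIn hlam H)) _ using 1
    ext (i | i) <;> rfl

/-- The core of smallness: `m` is `a` truncated at an index `j ≥ i` where the component of `a` is
outside `Q`. A multiple of that component by `n ≠ 0` is still outside `Q`, because `Q` is divisible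
and `G` torsion-free, so `c` cannot cancel it. -/
theorem exists_same_sign (hQ : ∀ n : ℕ, n ≠ 0 → ∀ q ∈ Q, ∃ r ∈ Q, n • r = q)
    (hQH : ∀ x ∈ Q, x ∈ H → x = 0) (a : eventuallyIn hlam H) (i : lam.ord.ToType) :
    ∃ m : boundedPower lam G hlam, ∀ (n : ℤ) (c : FullPower lam G), c ∈ fromIn i Q →
      SignType.sign (n • (m : FullPower lam G) + c) =
        SignType.sign (n • (a : FullPower lam G) + c) := by
  by_cases ha : (a : FullPower lam G) ∈ boundedPower lam G hlam
  · exact ⟨⟨a, ha⟩, fun _ _ _ => rfl⟩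
  · obtain ⟨k, hk⟩ := a.2
    obtain ⟨j, hj, hj0⟩ : ∃ j, max i k ≤ j ∧ coord j (a : FullPower lam G) ≠ 0 := by
      by_contra! hc
      exact ha ⟨max i k, hc⟩
    have hjQ : coord j (a : FullPower lam G) ∉ Q := fun h =>
      hj0 (hQH _ h (hk j ((le_max_right _ _).trans hj)))
    refine ⟨trunc hlam j a, fun n c hc => ?_⟩
    by_cases hn : n = 0
    · simp [hn]
    · refine (sign_eq_of_agree (j := j) (fun l hl => ?_) fun h => hjQ ?_).symm
      · rw [map_add, map_add, map_zsmul, map_zsmul, coord_trunc, if_pos hl]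
      · rw [map_add, map_zsmul] at h
        have h' : n • coord j (a : FullPower lam G) ∈ Q := by
          rw [eq_neg_of_add_eq_zero_left h]
          exact Q.neg_mem (hc j ((le_max_left _ _).trans hj))
        have h'' : n.natAbs • coord j (a : FullPower lam G) ∈ Q := by
          rcases Int.natAbs_eq n with e | e
          · rwa [e, natCast_zsmul] at h'
          · rw [e, neg_smul, natCast_zsmul] at h'
            exact neg_mem_iff.1 h'
        obtain ⟨r, hr, hr'⟩ := hQ n.natAbs (by simpa using hn) _ h''
        exact nsmul_right_injective (by simpa using hn) hr' ▸ hr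

theorem isSmallExtension_boundedPowerEmbedding [Nontrivial G] (hG : IsDivisible G)
    (hQ : ∀ n : ℕ, n ≠ 0 → ∀ q ∈ Q, ∃ r ∈ Q, n • r = q)
    (hH : ∀ n : ℕ, n ≠ 0 → ∀ q ∈ H, ∃ r ∈ H, n • r = q) (hQH : ∀ x ∈ Q, x ∈ H → x = 0)
    (hH0 : ∃ h ∈ H, h ≠ 0) :
    IsSmallExtension (boundedPowerEmbedding hlam (Q := Q) hG hH) := by
  classical
  constructor
  · intro hs
    obtain ⟨h, hh, h0⟩ := hH0
    obtain ⟨i, -⟩ := (boundedPower lam G hlam).zero_mem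
    -- A constant sequence with nonzero value in `H` is never eventually zero, so the extension is
    -- proper.
    obtain ⟨⟨m, k, hk⟩, hm⟩ := hs ⟨toLex fun _ => h, i, fun _ _ => hh⟩
    have := congrArg (fun x : eventuallyIn hlam H => coord k (x : FullPower lam G)) hm
    exact h0 (this.symm.trans (hk k le_rfl))
  · intro a A hA
    have := nontrivial_boundedPower (G := G) hlam
    have : Nontrivial (eventuallyIn hlam H) :=
      (AddSubgroup.inclusion_injective (boundedPower_le_eventuallyIn hlam H)).nontrivial
    have : Nonempty lam.ord.ToType :=
      ⟨(boundedPower lam G hlam).zero_mem.choose⟩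
    choose b hb using fun x : boundedPower lam G hlam => x.2
    -- From `i` on all parameters vanish, so integral combinations of parameters and constants have
    -- components in `Q` there.
    obtain ⟨i, hi⟩ := (hA.image b).bddAbove
    obtain ⟨m, hm⟩ := exists_same_sign hlam hQ hQH a i
    refine ⟨m, Set.ext fun φ => ?_⟩
    refine realize_iff_of_sameSigns (hG.boundedPower hlam) (hG.eventuallyIn hlam hH) ?_ φ
    intro f _
    let C := boundedPowerConsts lam hlam Q
    obtain ⟨n, g, hng⟩ := exists_affine_of_linearCombination.{u}
      (f.mapDomain (Equiv.sumAssoc C A Unit).symm)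
    let p : C ⊕ A → boundedPower lam G hlam := Sum.elim (↑) (↑)
    have e₁ := hng _ p m
    have e₂ := hng _ (AddSubgroup.inclusion (boundedPower_le_eventuallyIn hlam H) ∘ p) a
    rw [Finsupp.linearCombination_mapDomain] at e₁ e₂
    have hc : ((Finsupp.linearCombination ℤ p g : boundedPower lam G hlam) : FullPower lam G) ∈
        fromIn i Q := by
      rw [Finsupp.linearCombination_apply, Finsupp.sum, AddSubgroup.val_finsetSum]
      refine AddSubgroup.sum_mem _ fun t _ => ?_
      rw [AddSubgroup.coe_zsmul]
      refine AddSubgroup.zsmul_mem _ ?_ _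
      rcases t with t | t
      · exact fun j _ => t.2 j
      · intro j hj
        have : coord j ((t : boundedPower lam G hlam) : FullPower lam G) = 0 :=
          hb _ j ((hi (Set.mem_image_of_mem b t.2)).trans hj)
        exact this ▸ Q.zero_mem
    have hs := hm n _ hc
    rw [linearCombination_map_comp] at e₂
    have hs' := congrArg SignType.sign e₁
    have hs'' := congrArg SignType.sign e₂
    rw [← sign_map_of_strictMono (AddSubgroup.subtype _) (fun _ _ h => h) (n • m + _)] at hs'
    rw [← sign_map_of_strictMono (AddSubgroup.subtype _) (fun _ _ h => h) (n • a + _)] at hs''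
    have e := hs'.trans (hs.trans hs''.symm)
    convert! e using 4
    · ext (t | t | t) <;> rfl
    · ext (t | t | t) <;> rfl

end Extension

/-! ### First-order axioms of ordered groups -/

section Axioms

/-- The sum of two terms. -/
def addTerm {ι : Type*} (s t : ordGroupLang.Term ι) : ordGroupLang.Term ι :=
  Functions.apply₂ (L := ordGroupLang) OrdGroupFunc.add s t

/-- The negative of a term. -/
def negTerm {ι : Type*} (t : ordGroupLang.Term ι) : ordGroupLang.Term ι :=
  Functions.apply₁ (L := ordGroupLang) OrdGroupFunc.neg t

/-- The term `0`. -/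
def zeroTerm {ι : Type*} : ordGroupLang.Term ι :=
  Constants.term (L := ordGroupLang) (OrdGroupFunc.zero : ordGroupLang.Functions 0)

/-- The formula `s ≤ t`. -/
def leFormula {ι : Type*} {n : ℕ} (s t : ordGroupLang.Term (ι ⊕ Fin n)) :
    ordGroupLang.BoundedFormula ι n :=
  Relations.boundedFormula₂ (L := ordGroupLang) orderRel.le s t

section

variable {N : Type*} [ordGroupLang.Structure N] {ι : Type*}

@[simp]
theorem realize_addTerm (s t : ordGroupLang.Term ι) (v : ι → N) :
    (addTerm s t).realize v =
      Structure.funMap (L := ordGroupLang) OrdGroupFunc.add ![s.realize v, t.realize v] :=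
  Term.realize_functions_apply₂

@[simp]
theorem realize_negTerm (t : ordGroupLang.Term ι) (v : ι → N) :
    (negTerm t).realize v = Structure.funMap (L := ordGroupLang) OrdGroupFunc.neg ![t.realize v] :=
  Term.realize_functions_apply₁

@[simp]
theorem realize_zeroTerm (v : ι → N) :
    (zeroTerm : ordGroupLang.Term ι).realize v =
      Structure.funMap (L := ordGroupLang) OrdGroupFunc.zero ![] :=
  congrArg (Structure.funMap (L := ordGroupLang) OrdGroupFunc.zero) (Subsingleton.elim _ _)

@[simp]
theorem realize_leFormula {n : ℕ} (s t : ordGroupLang.Term (ι ⊕ Fin n)) (v : ι → N)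
    (xs : Fin n → N) :
    (leFormula s t).Realize v xs ↔ Structure.RelMap (L := ordGroupLang) orderRel.le
      ![s.realize (Sum.elim v xs), t.realize (Sum.elim v xs)] :=
  BoundedFormula.realize_rel₂

end

/-- An ordered group structure is defined by a first-order structure that satisfies the sentences
true in some ordered group. -/
theorem exists_orderedGroup_of_sentences {A : Type*} [AddCommGroup A] [LinearOrder A]
    [IsOrderedAddMonoid A] {N : Type*} [ordGroupLang.Structure N]
    (h : ∀ φ : ordGroupLang.Sentence, A ⊨ φ → N ⊨ φ) :
    ∃ (_ : AddCommGroup N) (_ : LinearOrder N) (_ : IsOrderedAddMonoid N),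
      (∀ x y : N, Structure.funMap (L := ordGroupLang) OrdGroupFunc.add ![x, y] = x + y) ∧
      (∀ x y : N, Structure.RelMap (L := ordGroupLang) orderRel.le ![x, y] ↔ x ≤ y) := by
  classical
  let add : N → N → N := fun x y => Structure.funMap (L := ordGroupLang) OrdGroupFunc.add ![x, y]
  let neg : N → N := fun x => Structure.funMap (L := ordGroupLang) OrdGroupFunc.neg ![x]
  let zero : N := Structure.funMap (L := ordGroupLang) OrdGroupFunc.zero ![]
  let le : N → N → Prop := fun x y => Structure.RelMap (L := ordGroupLang) orderRel.le ![x, y]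
  have assoc : ∀ x y z, add (add x y) z = add x (add y z) := by
    have := h (∀' ∀' ∀' ((addTerm (addTerm (&0) (&1)) (&2)) =' (addTerm (&0) (addTerm (&1) (&2)))))
      (by
        simp [Sentence.Realize, Formula.Realize, Fin.snoc]
        intro x y z
        exact add_assoc x y z)
    simp [Sentence.Realize, Formula.Realize, Fin.snoc] at this
    exact this
  have comm : ∀ x y, add x y = add y x := by
    have := h (∀' ∀' ((addTerm (&0) (&1)) =' (addTerm (&1) (&0))))
      (by
        simp [Sentence.Realize, Formula.Realize, Fin.snoc]
        exact add_comm)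
    simp [Sentence.Realize, Formula.Realize, Fin.snoc] at this
    exact this
  have zero_add : ∀ x, add zero x = x := by
    have := h (∀' ((addTerm zeroTerm (&0)) =' (&0)))
      (by
        simp [Sentence.Realize, Formula.Realize, Fin.snoc]
        exact zero_add)
    simp [Sentence.Realize, Formula.Realize, Fin.snoc] at this
    exact this
  have neg_add : ∀ x, add (neg x) x = zero := by
    have := h (∀' ((addTerm (negTerm (&0)) (&0)) =' zeroTerm))
      (by
        simp [Sentence.Realize, Formula.Realize, Fin.snoc]
        exact neg_add_cancel)
    simp [Sentence.Realize, Formula.Realize, Fin.snoc] at this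
    exact this
  have refl : ∀ x, le x x := by
    have := h (∀' (leFormula (&0) (&0)))
      (by
        simp [Sentence.Realize, Formula.Realize, Fin.snoc]
        exact le_refl)
    simp [Sentence.Realize, Formula.Realize, Fin.snoc] at this
    exact this
  have trans : ∀ x y z, le x y → le y z → le x z := by
    have := h (∀' ∀' ∀' ((leFormula (&0) (&1)) ⟹ (leFormula (&1) (&2)) ⟹ (leFormula (&0) (&2))))
      (by
        simp [Sentence.Realize, Formula.Realize, Fin.snoc]
        exact fun _ _ _ => le_trans)
    simp [Sentence.Realize, Formula.Realize, Fin.snoc] at this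
    exact this
  have antisymm : ∀ x y, le x y → le y x → x = y := by
    have := h (∀' ∀' ((leFormula (&0) (&1)) ⟹ (leFormula (&1) (&0)) ⟹ ((&0) =' (&1))))
      (by
        simp [Sentence.Realize, Formula.Realize, Fin.snoc]
        exact fun _ _ => le_antisymm)
    simp [Sentence.Realize, Formula.Realize, Fin.snoc] at this
    exact this
  have total : ∀ x y, le x y ∨ le y x := by
    have := h (∀' ∀' ((leFormula (&0) (&1)) ⊔ (leFormula (&1) (&0))))
      (by
        simp [Sentence.Realize, Formula.Realize, Fin.snoc]
        exact le_total)
    simp [Sentence.Realize, Formula.Realize, Fin.snoc] at this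
    exact this
  have add_le : ∀ x y z, le x y → le (add x z) (add y z) := by
    have := h (∀' ∀' ∀' ((leFormula (&0) (&1)) ⟹
        (leFormula (addTerm (&0) (&2)) (addTerm (&1) (&2)))))
      (by
        simp [Sentence.Realize, Formula.Realize, Fin.snoc]
        exact fun x y z hxy => add_le_add_left hxy z)
    simp [Sentence.Realize, Formula.Realize, Fin.snoc] at this
    exact this
  let grp : AddCommGroup N :=
    { add := add, zero := zero, neg := neg
      add_assoc := assoc
      zero_add := zero_add
      add_zero := fun x => (comm x zero).trans (zero_add x)
      neg_add_cancel := neg_add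
      add_comm := comm
      nsmul := @nsmulRec N ⟨zero⟩ ⟨add⟩
      zsmul := @zsmulRec N ⟨zero⟩ ⟨add⟩ ⟨neg⟩ (@nsmulRec N ⟨zero⟩ ⟨add⟩) }
  let ord : LinearOrder N :=
    { le := le
      le_refl := refl
      le_trans := trans
      le_antisymm := antisymm
      le_total := total
      toDecidableLE := Classical.decRel _ }
  exact ⟨grp, ord, @IsOrderedAddMonoid.mk N _ _ (fun x y hxy z => add_le x y z hxy)
    (fun x y hxy z => by rw [add_comm z, add_comm z]; exact add_le x y z hxy),
    fun _ _ => rfl, fun _ _ => Iff.rfl⟩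

end Axioms

/-! ### The ordered group underlying a small extension -/

section Small

variable {lam : Cardinal.{u}} {G : Type u} [AddCommGroup G] [LinearOrder G] [IsOrderedAddMonoid G]
  {hlam : ℵ₀ ≤ lam} {Q : AddSubgroup G}

/-- The symbol for addition. -/
def addConstLang (hlam : ℵ₀ ≤ lam) (Q : AddSubgroup G) : (constLang lam hlam Q).Functions 2 :=
  Sum.inl OrdGroupFunc.add

/-- The symbol for the order. -/
def leConstLang (hlam : ℵ₀ ≤ lam) (Q : AddSubgroup G) : (constLang lam hlam Q).Relations 2 :=
  Sum.inl orderRel.le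

/-- The symbols for addition and order are interpreted by those of an ordered group. -/
structure InterpretsGroup (hlam : ℵ₀ ≤ lam) (Q : AddSubgroup G) (N : Type w₁)
    [(constLang lam hlam Q).Structure N] [AddCommGroup N] [LinearOrder N] : Prop where
  add_eq (x y : N) : Structure.funMap (addConstLang hlam Q) ![x, y] = x + y
  le_iff (x y : N) : Structure.RelMap (leConstLang hlam Q) ![x, y] ↔ x ≤ y

/-- A small extension of `G^{<λ}` is an ordered group all of whose elements have the same cut
over the constants as some element of `G^{<λ}`. -/
theorem IsSmallExtension.exists_orderedGroup {N : Type w₁} [(constLang lam hlam Q).Structure N]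
    {f : boundedPower lam G hlam ↪ₑ[constLang lam hlam Q] N} (hf : IsSmallExtension f) :
    ∃ (_ : AddCommGroup N) (_ : LinearOrder N) (_ : IsOrderedAddMonoid N),
      InterpretsGroup hlam Q N ∧
      ∀ a : N, ∃ m : boundedPower lam G hlam, ∀ c ∈ boundedPowerConsts lam hlam Q,
        (f c < a ↔ c < m) ∧ (a < f c ↔ m < c) := by
  let L := constLang lam hlam Q
  let _ := (lhomWithConstants ordGroupLang (boundedPowerConsts lam hlam Q)).reduct N
  obtain ⟨grp, ord, hord, hadd, hle⟩ := exists_orderedGroup_of_sentences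
    (A := boundedPower lam G hlam) (N := N) fun φ hφ => by
      rw [← LHom.realize_onSentence _
        (lhomWithConstants ordGroupLang (boundedPowerConsts lam hlam Q))] at hφ ⊢
      exact (f.map_sentence _).1 hφ
  refine ⟨grp, ord, hord, ⟨hadd, hle⟩, fun a => ?_⟩
  -- The empty parameter set suffices, as the elements of `Q^{<λ}` are named by constants.
  obtain ⟨m, hm⟩ := hf.2 a ∅ Set.finite_empty
  refine ⟨m, fun c hc => ?_⟩
  let k : L.Constants := ordGroupLang.con (⟨c, hc⟩ : boundedPowerConsts lam hlam Q)
  have hk : ((k : L.Constants) : N) = f c := (f.map_constants k).symm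
  let ct : L.Term ((∅ : Set (boundedPower lam G hlam)) ⊕ Unit) := Constants.term k
  let x : L.Term ((∅ : Set (boundedPower lam G hlam)) ⊕ Unit) := Term.var (Sum.inr ())
  have h₁ := Set.ext_iff.1 hm (Relations.formula₂ (leConstLang hlam Q) ct x)
  have h₂ := Set.ext_iff.1 hm (Relations.formula₂ (leConstLang hlam Q) x ct)
  simp only [tpOver, Set.mem_ofPred_eq] at h₁ h₂
  let vN : (∅ : Set (boundedPower lam G hlam)) ⊕ Unit → N := Sum.elim (fun x => f x) fun _ => a
  let vM : (∅ : Set (boundedPower lam G hlam)) ⊕ Unit → boundedPower lam G hlam :=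
    Sum.elim (fun x => x) fun _ => m
  change Formula.Realize _ vM ↔ Formula.Realize _ vN at h₁ h₂
  have key : ∀ s t : L.Term ((∅ : Set (boundedPower lam G hlam)) ⊕ Unit),
      (Relations.formula₂ (leConstLang hlam Q) s t).Realize vN ↔
        s.realize vN ≤
          t.realize vN := fun s t =>
    Formula.realize_rel₂.trans (hle _ _)
  have key' : ∀ s t : L.Term ((∅ : Set (boundedPower lam G hlam)) ⊕ Unit),
      (Relations.formula₂ (leConstLang hlam Q) s t).Realize vM ↔
        s.realize vM ≤
          t.realize vM := fun s t =>
    Formula.realize_rel₂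
  rw [key, key'] at h₁ h₂
  have e₁ : ct.realize vN = f c :=
    Term.realize_constants.trans hk
  have e₂ : ct.realize vM = c := Term.realize_constants
  rw [e₁, e₂] at h₁ h₂
  have h₁' : c ≤ m ↔ f c ≤ a := h₁
  have h₂' : m ≤ c ↔ a ≤ f c := h₂
  rw [← not_le, ← not_le, ← not_le, ← not_le, h₁', h₂']
  exact ⟨Iff.rfl, Iff.rfl⟩

/-- An elementary embedding is additive and strictly monotone if the structures are
ordered groups. -/
theorem exists_strictMono_addMonoidHom {M : Type w₁} {N : Type w₂}
    [(constLang lam hlam Q).Structure M] [(constLang lam hlam Q).Structure N]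
    [AddCommGroup M] [LinearOrder M] [AddCommGroup N] [LinearOrder N]
    (hM : InterpretsGroup hlam Q M) (hN : InterpretsGroup hlam Q N)
    (f : M ↪ₑ[constLang lam hlam Q] N) : ∃ g : M →+ N, StrictMono g ∧ ⇑g = f := by
  refine ⟨AddMonoidHom.mk' f fun x y => ?_, ?_, rfl⟩
  · rw [← hM.add_eq, f.map_fun, ← hN.add_eq]
    congr 1
    ext i
    fin_cases i <;> rfl
  · have h : ∀ x y, f x ≤ f y ↔ x ≤ y := by
      intro x y
      rw [← hM.le_iff, ← hN.le_iff, ← f.map_rel]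
      have : (f ∘ ![x, y] : Fin 2 → N) = ![f x, f y] := by
        ext i
        fin_cases i <;> rfl
      rw [this]
    intro x y hxy
    exact lt_of_not_ge fun hc => hxy.not_ge ((h y x).1 hc)

end Small

/-! ### Sequences attached to elements of a small extension -/

section Representation

open FullPower

variable {lam : Cardinal.{u}} {G : Type u} [AddCommGroup G] [LinearOrder G] [IsOrderedAddMonoid G]
  {hlam : ℵ₀ ≤ lam} {Q : AddSubgroup G}

theorem singleAt_mem_boundedPowerConsts (i : lam.ord.ToType) {q : G} (hq : q ∈ Q) :
    singleAt hlam i q ∈ boundedPowerConsts lam hlam Q := by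
  intro j
  change (if j = i then q else 0) ∈ Q
  split_ifs
  exacts [hq, Q.zero_mem]

theorem trunc_mem_boundedPowerConsts (i : lam.ord.ToType) {x : FullPower lam G}
    (hx : ∀ j, coord j x ∈ Q) : trunc hlam i x ∈ boundedPowerConsts lam hlam Q := by
  intro j
  change (if j ≤ i then coord j x else 0) ∈ Q
  split_ifs
  exacts [hx j, Q.zero_mem]

theorem add_mem_boundedPowerConsts {x y : boundedPower lam G hlam}
    (hx : x ∈ boundedPowerConsts lam hlam Q) (hy : y ∈ boundedPowerConsts lam hlam Q) :
    x + y ∈ boundedPowerConsts lam hlam Q := fun j => Q.add_mem (hx j) (hy j)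

theorem coord_singleAt_of_ne {i j : lam.ord.ToType} (h : j ≠ i) (g : G) :
    coord j (singleAt hlam i g : FullPower lam G) = 0 := if_neg h

theorem coord_singleAt_self (i : lam.ord.ToType) (g : G) :
    coord i (singleAt hlam i g : FullPower lam G) = g := if_pos rfl

theorem lt_singleAt_of_coord_eq_zero {y : FullPower lam G} {i : lam.ord.ToType}
    (hy : ∀ k ≤ i, coord k y = 0) {q : G} (hq : 0 < q) :
    y < (singleAt hlam i q : FullPower lam G) := by
  refine lt_iff.2 ⟨i, fun j hj => ?_, ?_⟩
  · rw [hy j hj.le, coord_singleAt_of_ne hj.ne]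
  · rwa [hy i le_rfl, coord_singleAt_self]

theorem singleAt_strictMono (i : lam.ord.ToType) : StrictMono (singleAt (G := G) hlam i) := by
  intro g h hgh
  refine lt_iff.2 ⟨i, fun j hj => ?_, ?_⟩
  · rw [coord_singleAt_of_ne hj.ne, coord_singleAt_of_ne hj.ne]
  · rwa [coord_singleAt_self, coord_singleAt_self]

variable {N : Type w₁} [AddCommGroup N] [LinearOrder N] [IsOrderedAddMonoid N]
  {f : boundedPower lam G hlam →+ N}

/-- `y` is infinitesimal with respect to all constants whose leading component has index `i`. -/
def IsInfinitesimal (Q : AddSubgroup G) (f : boundedPower lam G hlam →+ N) (i : lam.ord.ToType)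
    (y : N) : Prop :=
  ∀ q ∈ Q, 0 < q → |y| < f (singleAt hlam i q)

theorem IsInfinitesimal.neg {i : lam.ord.ToType} {y : N} (h : IsInfinitesimal Q f i y) :
    IsInfinitesimal Q f i (-y) := fun q hq h0 => by
  rw [abs_neg]; exact h q hq h0

theorem IsInfinitesimal.add (hQ : ∀ n : ℕ, n ≠ 0 → ∀ q ∈ Q, ∃ r ∈ Q, n • r = q)
    {i : lam.ord.ToType} {y z : N} (hy : IsInfinitesimal Q f i y) (hz : IsInfinitesimal Q f i z) :
    IsInfinitesimal Q f i (y + z) := by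
  intro q hq h0
  obtain ⟨r, hr, rfl⟩ := hQ 2 two_ne_zero q hq
  have hr0 : 0 < r := by
    by_contra! hc
    exact h0.not_ge (nsmul_nonpos hc 2)
  rw [two_nsmul, map_add, map_add]
  exact (abs_add_le y z).trans_lt (add_lt_add (hy r hr hr0) (hz r hr hr0))

theorem IsInfinitesimal.sub (hQ : ∀ n : ℕ, n ≠ 0 → ∀ q ∈ Q, ∃ r ∈ Q, n • r = q)
    {i : lam.ord.ToType} {y z : N} (hy : IsInfinitesimal Q f i y) (hz : IsInfinitesimal Q f i z) :
    IsInfinitesimal Q f i (y - z) := sub_eq_add_neg y z ▸ hy.add hQ hz.neg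

theorem IsInfinitesimal.mono (hf : StrictMono f) {i j : lam.ord.ToType} (hij : i ≤ j) {y : N}
    (h : IsInfinitesimal Q f j y) : IsInfinitesimal Q f i y := by
  intro q hq h0
  rcases hij.eq_or_lt with rfl | hij
  · exact h q hq h0
  · refine (h q hq h0).trans (hf ?_)
    exact lt_singleAt_of_coord_eq_zero
      (fun k hk => coord_singleAt_of_ne (hk.trans_lt hij).ne q) h0

/-- If the leading index `k` of `x` is at most `i`, density gives a positive `q` in `Q` below the
absolute value of the `k`-th component, and `singleAt hlam i q` lies below `|x|`. -/
theorem isInfinitesimal_map_iff (hf : StrictMono f)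
    (hdense : ∀ a b : G, a < b → ∃ q ∈ Q, a < q ∧ q < b) {i : lam.ord.ToType}
    {x : boundedPower lam G hlam} :
    IsInfinitesimal Q f i (f x) ↔ ∀ k ≤ i, coord k (x : FullPower lam G) = 0 := by
  constructor
  · intro h
    by_contra! hc
    obtain ⟨k, ⟨hki, hk0⟩, hmin⟩ := wellFounded_lt.has_min
      {k | k ≤ i ∧ coord k (x : FullPower lam G) ≠ 0} hc
    have hlt : ∀ l < k, coord l (x : FullPower lam G) = 0 := fun l hl => by
      by_contra h0
      exact hmin l ⟨hl.le.trans hki, h0⟩ hl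
    have key : ∀ y : boundedPower lam G hlam, (∀ l < k, coord l (y : FullPower lam G) = 0) →
        0 < coord k (y : FullPower lam G) → f y ≤ |f x| → False := by
      intro y hy hy0 hyx
      obtain ⟨q, hq, hq0, hqy⟩ := hdense _ _ hy0
      refine absurd (hyx.trans_lt (h q hq hq0)) (not_lt.2 (hf.monotone (le_of_lt ?_)))
      refine lt_iff.2 ⟨k, fun l hl => ?_, ?_⟩
      · rw [hy l hl, coord_singleAt_of_ne (hl.trans_le hki).ne]
      · rw [coord_singleAt]
        split_ifs
        exacts [hqy, hy0]
    rcases lt_or_gt_of_ne hk0 with h0 | h0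
    · refine key (-x) (fun l hl => ?_) ?_ ?_
      · rw [AddSubgroup.coe_neg, map_neg, hlt l hl, neg_zero]
      · rw [AddSubgroup.coe_neg, map_neg]; exact neg_pos.2 h0
      · rw [map_neg]; exact neg_le_abs _
    · exact key x hlt h0 (le_abs_self _)
  · intro h q _ hq0
    rw [abs_lt, neg_lt, ← map_neg]
    refine ⟨hf ?_, hf ?_⟩
    · exact lt_singleAt_of_coord_eq_zero (y := ((-x : boundedPower lam G hlam) : FullPower lam G))
        (fun k hk => by rw [AddSubgroup.coe_neg, map_neg, h k hk, neg_zero]) hq0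
    · exact lt_singleAt_of_coord_eq_zero h hq0

/-- The sequence `x` gives the components of the element `a`. -/
def Represents (Q : AddSubgroup G) (f : boundedPower lam G hlam →+ N) (a : N)
    (x : FullPower lam G) : Prop :=
  ∀ i, IsInfinitesimal Q f i (a - f (trunc hlam i x))

/-- Every element has the same cut over the constants as some element of `G^{<λ}`. -/
def RealizesCuts (Q : AddSubgroup G) (f : boundedPower lam G hlam →+ N) : Prop :=
  ∀ a : N, ∃ m : boundedPower lam G hlam, ∀ c ∈ boundedPowerConsts lam hlam Q,
    (f c < a ↔ c < m) ∧ (a < f c ↔ m < c)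

theorem coord_eq_of_isInfinitesimal (hf : StrictMono f) (hQ : IsDenseDivisible Q) {a : N}
    {x y : FullPower lam G} {i j k : lam.ord.ToType} (hki : k ≤ i) (hkj : k ≤ j)
    (hx : IsInfinitesimal Q f i (a - f (trunc hlam i x)))
    (hy : IsInfinitesimal Q f j (a - f (trunc hlam j y))) : coord k x = coord k y := by
  have h := (hy.mono hf hkj).sub hQ.2.1 (hx.mono hf hki)
  rw [sub_sub_sub_cancel_left, ← map_sub, isInfinitesimal_map_iff hf hQ.2.2] at h
  have := h k le_rfl
  rwa [AddSubgroup.coe_sub, map_sub, coord_trunc, coord_trunc, if_pos hki, if_pos hkj,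
    sub_eq_zero] at this

theorem trunc_add_singleAt (i : lam.ord.ToType) {m : boundedPower lam G hlam}
    (hm : ∀ k, i ≤ k → coord k (m : FullPower lam G) = 0) (g : G) :
    trunc hlam i ((m + singleAt hlam i g : boundedPower lam G hlam) : FullPower lam G) =
      m + singleAt hlam i g := by
  refine Subtype.ext (ext_coord fun k => ?_)
  rw [coord_trunc]
  split_ifs with h
  · rfl
  · rw [not_le] at h
    rw [AddSubgroup.coe_add, map_add, hm k h.le, coord_singleAt_of_ne h.ne', add_zero]

/-- Transfinite induction: the earlier components are glued to `m₀`, and the component at `i` is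
read off from an element `m` of `G^{<λ}` with the same cut as `a - f m₀`. -/
theorem exists_trunc_isInfinitesimal (hf : StrictMono f) (hQ : IsDenseDivisible Q)
    (hr : RealizesCuts Q f) (a : N) (i : lam.ord.ToType) :
    ∃ x : FullPower lam G, IsInfinitesimal Q f i (a - f (trunc hlam i x)) := by
  induction i using WellFoundedLT.induction with
  | _ i ih =>
  choose x hx using ih
  let z : FullPower lam G := toLex fun k => if h : k < i then coord k (x k h) else 0
  have hz : ∀ k (h : k < i), coord k z = coord k (x k h) := fun k h => dif_pos h
  have hz' : ∀ k, i ≤ k → coord k z = 0 := fun k h => dif_neg h.not_gt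
  let m₀ : boundedPower lam G hlam := ⟨z, i, hz'⟩
  have hm₀ : ∀ j < i, IsInfinitesimal Q f j (a - f m₀) := by
    intro j hj
    have e : a - f m₀ = (a - f (trunc hlam j (x j hj))) + f (trunc hlam j (x j hj) - m₀) := by
      rw [map_sub]; abel
    rw [e]
    refine (hx j hj).add hQ.2.1 ((isInfinitesimal_map_iff hf hQ.2.2).2 fun k hk => ?_)
    rw [AddSubgroup.coe_sub, map_sub, coord_trunc, if_pos hk, sub_eq_zero,
      show coord k (m₀ : FullPower lam G) = _ from hz k (hk.trans_lt hj)]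
    exact coord_eq_of_isInfinitesimal hf hQ hk le_rfl (hx j hj) (hx k _)
  obtain ⟨m, hm⟩ := hr (a - f m₀)
  -- Being infinitesimal is a statement about cuts over constants, so it passes from `a - f m₀` to
  -- `m`; the identity of `G^{<λ}` then plays the role of `f`.
  have hmj : ∀ j < i, coord j (m : FullPower lam G) = 0 := by
    intro j hj
    refine (isInfinitesimal_map_iff (f := AddMonoidHom.id _) (Q := Q) strictMono_id hQ.2.2
      (i := j)).1 (fun q hq hq0 => ?_) j le_rfl
    have h := hm₀ j hj q hq hq0
    rw [abs_lt, ← map_neg, ← map_neg, (hm _ (singleAt_mem_boundedPowerConsts j hq)).2,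
      (hm _ (singleAt_mem_boundedPowerConsts j (Q.neg_mem hq))).1] at h
    rw [AddMonoidHom.id_apply, AddMonoidHom.id_apply, abs_lt, ← map_neg]
    exact h
  let g : G := coord i (m : FullPower lam G)
  refine ⟨(m₀ + singleAt hlam i g : boundedPower lam G hlam), fun q hq hq0 => ?_⟩
  rw [trunc_add_singleAt i hz', map_add, ← sub_sub]
  -- `g` need not lie in `Q`, and only constants can be compared, so it is enclosed between elements
  -- of `Q` at distance less than `q`.
  obtain ⟨q₁, hq₁, h₁, h₁'⟩ := hQ.2.2 (g - q) g (sub_lt_self g hq0)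
  obtain ⟨q₂, hq₂, h₂, h₂'⟩ := hQ.2.2 g (g + q) (lt_add_of_pos_right g hq0)
  have b₁ : f (singleAt hlam i q₁) < a - f m₀ := by
    rw [(hm _ (singleAt_mem_boundedPowerConsts i hq₁)).1]
    refine lt_iff.2 ⟨i, fun j hj => ?_, ?_⟩
    · rw [coord_singleAt_of_ne hj.ne, hmj j hj]
    · rwa [coord_singleAt_self]
  have b₂ : a - f m₀ < f (singleAt hlam i q₂) := by
    rw [(hm _ (singleAt_mem_boundedPowerConsts i hq₂)).2]
    refine lt_iff.2 ⟨i, fun j hj => ?_, ?_⟩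
    · rw [coord_singleAt_of_ne hj.ne, hmj j hj]
    · rwa [coord_singleAt_self]
  have c₁ := (hf (singleAt_strictMono i h₁)).trans b₁
  have c₂ := b₂.trans (hf (singleAt_strictMono i h₂'))
  rw [map_sub, map_sub] at c₁
  rw [map_add, map_add] at c₂
  exact abs_sub_lt_iff.2 ⟨sub_lt_iff_lt_add'.2 c₂, sub_lt_comm.1 c₁⟩

theorem exists_represents (hf : StrictMono f) (hQ : IsDenseDivisible Q) (hr : RealizesCuts Q f)
    (a : N) : ∃ x : FullPower lam G, Represents Q f a x := by
  have h : ∀ i, ∃ x : FullPower lam G, IsInfinitesimal Q f i (a - f (trunc hlam i x)) :=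
    exists_trunc_isInfinitesimal hf hQ hr a
  choose x hx using h
  refine ⟨toLex fun i => coord i (x i), fun i => ?_⟩
  have e : trunc hlam i (toLex fun i => coord i (x i)) = trunc hlam i (x i) := by
    refine Subtype.ext (ext_coord fun k => ?_)
    rw [coord_trunc, coord_trunc]
    split_ifs with hk
    · exact (coord_eq_of_isInfinitesimal hf hQ le_rfl hk (hx k) (hx i) :
        coord k (x k) = coord k (x i))
    · rfl
  rw [e]
  exact hx i

theorem trunc_sub (i : lam.ord.ToType) (x y : FullPower lam G) :
    trunc hlam i (x - y) = trunc hlam i x - trunc hlam i y := by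
  refine Subtype.ext (ext_coord fun k => ?_)
  rw [AddSubgroup.coe_sub, map_sub, coord_trunc, coord_trunc, coord_trunc, map_sub]
  split_ifs
  exacts [rfl, (sub_zero _).symm]

theorem Represents.sub (hQ : IsDenseDivisible Q) {a b : N} {x y : FullPower lam G}
    (hx : Represents Q f a x) (hy : Represents Q f b y) : Represents Q f (a - b) (x - y) := by
  intro i
  have h := (hx i).sub hQ.2.1 (hy i)
  rwa [sub_sub_sub_comm, ← map_sub, ← trunc_sub] at h

theorem represents_map (hf : StrictMono f) (hQ : IsDenseDivisible Q)
    (m : boundedPower lam G hlam) : Represents Q f (f m) m := by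
  intro i
  rw [← map_sub, isInfinitesimal_map_iff hf hQ.2.2]
  intro k hk
  rw [AddSubgroup.coe_sub, map_sub, coord_trunc, if_pos hk, sub_self]

/-- If `a ≠ 0`, then `|a|` has the cut of some `m > 0`. A constant with a single positive component
at the leading index of `m` lies below `m`, hence below `|a|`, so `a` is not infinitesimal at that
index. -/
theorem Represents.eq_zero [Nontrivial G] (hQ : IsDenseDivisible Q) (hr : RealizesCuts Q f) {a : N}
    (h : Represents Q f a 0) : a = 0 := by
  have htrunc : ∀ i, trunc hlam i (0 : FullPower lam G) = 0 := fun i =>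
    Subtype.ext (ext_coord fun k => by rw [coord_trunc, map_zero, ite_self]; rfl)
  by_contra h0
  obtain ⟨m, hm⟩ := hr |a|
  have hzero : (0 : boundedPower lam G hlam) ∈ boundedPowerConsts lam hlam Q := fun _ => Q.zero_mem
  have hm0 : 0 < m := by
    rw [← (hm 0 hzero).1, map_zero]
    exact abs_pos.2 h0
  obtain ⟨i, hi, hi0⟩ := pos_iff.1 (show (0 : FullPower lam G) < m from hm0)
  obtain ⟨q, hq, hq0, hqm⟩ := hQ.2.2 _ _ hi0
  have h₁ := h i q hq hq0
  rw [htrunc, map_zero, sub_zero] at h₁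
  refine absurd h₁ (not_lt.2 (le_of_lt ?_))
  rw [(hm _ (singleAt_mem_boundedPowerConsts i hq)).1]
  refine lt_iff.2 ⟨i, fun j hj => ?_, ?_⟩
  · rw [coord_singleAt_of_ne hj.ne, hi j hj]
  · rwa [coord_singleAt_self]

theorem Represents.eq [Nontrivial G] (hQ : IsDenseDivisible Q) (hr : RealizesCuts Q f) {a b : N}
    {x : FullPower lam G} (ha : Represents Q f a x) (hb : Represents Q f b x) : a = b := by
  have := ha.sub hQ hb
  rw [sub_self] at this
  exact sub_eq_zero.1 (this.eq_zero hQ hr)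

/-- An element whose components are all in `Q` belongs to `G^{<λ}`. -/
theorem Represents.mem_range [Nontrivial G] (hf : StrictMono f) (hQ : IsDenseDivisible Q)
    (hr : RealizesCuts Q f) {a : N} {x : FullPower lam G} (h : Represents Q f a x)
    (hx : ∀ i, coord i x ∈ Q) : ∃ m, f m = a := by
  obtain ⟨m, hm⟩ := hr a
  have hmx : (m : FullPower lam G) = x := by
    refine ext_coord fun i => ?_
    -- As the components of `x` are in `Q`, its truncations are constants, so the bounds on `a - f
    -- (trunc hlam i x)` are cut conditions that transfer to `m`.
    have hi : IsInfinitesimal Q (AddMonoidHom.id _) i (AddMonoidHom.id _ (m - trunc hlam i x)) := by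
      intro q hq hq0
      have h₁ := h i q hq hq0
      have ht := trunc_mem_boundedPowerConsts (hlam := hlam) i hx
      have hs := singleAt_mem_boundedPowerConsts (hlam := hlam) i hq
      have hs' := singleAt_mem_boundedPowerConsts (hlam := hlam) i (Q.neg_mem hq)
      rw [abs_lt, sub_lt_iff_lt_add, lt_sub_iff_add_lt, ← map_neg, ← map_add, ← map_neg, ← map_add,
        (hm _ (add_mem_boundedPowerConsts hs ht)).2,
        (hm _ (add_mem_boundedPowerConsts hs' ht)).1] at h₁
      rw [AddMonoidHom.id_apply, AddMonoidHom.id_apply, abs_lt, sub_lt_iff_lt_add,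
        lt_sub_iff_add_lt, ← map_neg]
      exact h₁
    rw [isInfinitesimal_map_iff strictMono_id hQ.2.2] at hi
    have := hi i le_rfl
    rwa [AddSubgroup.coe_sub, map_sub, coord_trunc, if_pos le_rfl, sub_eq_zero] at this
  exact ⟨m, (hmx ▸ represents_map hf hQ m : Represents Q f (f m) x).eq hQ hr h⟩

end Representation

/-! ### Maximality -/

section Maximal

open FullPower

variable {lam : Cardinal.{u}} {G : Type u} [AddCommGroup G] [LinearOrder G] [IsOrderedAddMonoid G]
  {hlam : ℵ₀ ≤ lam} {Q H : AddSubgroup G}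

theorem interpretsGroup_boundedPower : InterpretsGroup hlam Q (boundedPower lam G hlam) :=
  ⟨fun _ _ => rfl, fun _ _ => Iff.rfl⟩

theorem interpretsGroup_eventuallyIn : InterpretsGroup hlam Q (eventuallyIn hlam H) :=
  ⟨fun _ _ => rfl, fun _ _ => Iff.rfl⟩

theorem IsSmallExtension.exists_realizesCuts {N : Type w₁} [(constLang lam hlam Q).Structure N]
    {f : boundedPower lam G hlam ↪ₑ[constLang lam hlam Q] N} (hf : IsSmallExtension f) :
    ∃ (_ : AddCommGroup N) (_ : LinearOrder N) (_ : IsOrderedAddMonoid N)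
      (g : boundedPower lam G hlam →+ N), InterpretsGroup hlam Q N ∧ StrictMono g ∧ ⇑g = f ∧
        RealizesCuts Q g := by
  obtain ⟨_, _, _, hN, hr⟩ := hf.exists_orderedGroup
  obtain ⟨g, hg, hgf⟩ := exists_strictMono_addMonoidHom interpretsGroup_boundedPower hN f
  refine ⟨_, _, inferInstance, g, hN, hg, hgf, ?_⟩
  unfold RealizesCuts
  rw [hgf]
  exact hr

theorem IsSmallExtension.mk_le [Nontrivial G] (hQ : IsDenseDivisible Q) {N : Type (max u v)}
    [(constLang lam hlam Q).Structure N]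
    {f : boundedPower lam G hlam ↪ₑ[constLang lam hlam Q] N} (hf : IsSmallExtension f) :
    #N ≤ Cardinal.lift.{v} #(FullPower lam G) := by
  obtain ⟨_, _, _, g, -, hg, -, hr⟩ := hf.exists_realizesCuts
  choose σ hσ using exists_represents hg hQ hr
  rw [← mk_uLift]
  refine mk_le_of_injective (f := fun a => ULift.up (σ a)) fun a b hab => ?_
  have : σ a = σ b := congrArg ULift.down hab
  exact (hσ a).eq hQ hr (this ▸ hσ b)

theorem surjective_of_isSmallExtension_comp [Nontrivial G] (hQ : IsDenseDivisible Q)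
    (hH : ∀ n : ℕ, n ≠ 0 → ∀ q ∈ H, ∃ r ∈ H, n • r = q)
    (hsum : ∀ g : G, ∃ q ∈ Q, ∃ h ∈ H, q + h = g)
    {N : Type w₁} [(constLang lam hlam Q).Structure N]
    (g : eventuallyIn hlam H ↪ₑ[constLang lam hlam Q] N)
    (hg : IsSmallExtension (g.comp (boundedPowerEmbedding hlam (Q := Q) hQ.1 hH))) :
    Function.Surjective g := by
  obtain ⟨_, _, _, f, hN, hf, hfg, hr⟩ := hg.exists_realizesCuts
  obtain ⟨g', hg', hgg'⟩ := exists_strictMono_addMonoidHom interpretsGroup_eventuallyIn hN g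
  have hfg' : ∀ m, f m = g' (AddSubgroup.inclusion (boundedPower_le_eventuallyIn hlam H) m) := by
    intro m
    rw [hfg, hgg']
    rfl
  -- Inside the larger structure an element of `N` is still represented by itself.
  have hrep : ∀ n : eventuallyIn hlam H, Represents Q f (g' n) n := by
    intro n i q _ hq0
    rw [hfg', hfg', ← map_sub, abs_lt, neg_lt, ← map_neg]
    refine ⟨hg' ?_, hg' ?_⟩
    · refine lt_singleAt_of_coord_eq_zero (hlam := hlam) (y := -((n : FullPower lam G) -
        (trunc hlam i (n : FullPower lam G) : FullPower lam G)))
        (fun k hk => ?_) hq0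
      rw [map_neg, map_sub, coord_trunc, if_pos hk, sub_self, neg_zero]
    · refine lt_singleAt_of_coord_eq_zero (hlam := hlam) (y := (n : FullPower lam G) -
        (trunc hlam i (n : FullPower lam G) : FullPower lam G))
        (fun k hk => ?_) hq0
      rw [map_sub, coord_trunc, if_pos hk, sub_self]
  intro a
  obtain ⟨x, hx⟩ := exists_represents hf hQ hr a
  choose q hq h hh hqh using hsum
  obtain ⟨i₀, -⟩ := (boundedPower lam G hlam).zero_mem
  -- `n` collects the `H`-parts of the components of `x`, so `x - n` has all components in `Q`.
  let n : eventuallyIn hlam H := ⟨toLex fun i => h (coord i x), i₀, fun _ _ => hh _⟩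
  obtain ⟨m, hm⟩ := (hx.sub hQ (hrep n)).mem_range hf hQ hr fun i => by
    rw [map_sub]
    have : coord i x - h (coord i x) = q (coord i x) := sub_eq_of_eq_add (hqh _).symm
    exact (this ▸ hq _ : coord i x - h (coord i x) ∈ Q)
  refine ⟨AddSubgroup.inclusion (boundedPower_le_eventuallyIn hlam H) m + n, ?_⟩
  rw [← hgg', map_add, ← hfg', hm, sub_add_cancel]

theorem isMaximalSmallExtension_boundedPowerEmbedding [Nontrivial G] (hQ : IsDenseDivisible Q)
    (hH : ∀ n : ℕ, n ≠ 0 → ∀ q ∈ H, ∃ r ∈ H, n • r = q) (hQH : ∀ x ∈ Q, x ∈ H → x = 0)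
    (hsum : ∀ g : G, ∃ q ∈ Q, ∃ h ∈ H, q + h = g) (hH0 : ∃ h ∈ H, h ≠ 0)
    (hcard : #(FullPower lam G) ≤ #(eventuallyIn hlam H)) :
    IsMaximalSmallExtension.{u, v} (boundedPowerEmbedding hlam (Q := Q) hQ.1 hH) := by
  have hle : ∀ (N' : Type (max u v)) [(constLang lam hlam Q).Structure N']
      (f' : boundedPower lam G hlam ↪ₑ[constLang lam hlam Q] N'),
      IsSmallExtension f' → #N' ≤ Cardinal.lift.{v} #(eventuallyIn hlam H) := fun N' _ f' hf' =>
    (hf'.mk_le hQ).trans (Cardinal.lift_le.2 hcard)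
  refine ⟨isSmallExtension_boundedPowerEmbedding hlam hQ.1 hQ.2.1 hH hQH hH0, fun hu => ?_, hle,
    fun N' _ g hg => surjective_of_isSmallExtension_comp hQ hH hsum g hg⟩
  obtain ⟨N', _, f', hf', hc⟩ := hu (Order.succ (Cardinal.lift.{v} #(eventuallyIn hlam H)))
  exact absurd (hc.trans (hle N' f' hf')) (not_le.2 (Order.lt_succ _))

end Maximal

/-! ### A dense divisible subgroup with a large complement -/

section DenseSubgroup

/-- The sum of the components of a finitely supported sequence. -/
noncomputable def lexSum (V : Type u) [AddCommGroup V] : Lex (ℕ →₀ V) →+ V :=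
  (Finsupp.liftAddHom fun _ => AddMonoidHom.id V : (ℕ →₀ V) →+ V)

/-- The finitely supported sequence with the single component `v` at the index `n`. -/
noncomputable def lexSingle {V : Type u} [AddCommGroup V] (n : ℕ) : V →+ Lex (ℕ →₀ V) :=
  (Finsupp.singleAddHom n : V →+ (ℕ →₀ V))

theorem lexSum_lexSingle {V : Type u} [AddCommGroup V] (n : ℕ) (v : V) :
    lexSum V (lexSingle n v) = v :=
  Finsupp.liftAddHom_apply_single (fun _ => AddMonoidHom.id V) n v

theorem IsDivisible.lex_finsupp {ι V : Type*} [AddCommGroup V] (hV : IsDivisible V) :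
    IsDivisible (Lex (ι →₀ V)) := by
  intro n hn g
  change ∃ h : ι →₀ V, n • h = (g : ι →₀ V)
  induction (g : ι →₀ V) using Finsupp.induction_linear with
  | zero => exact ⟨0, smul_zero _⟩
  | add f g hf hg =>
    obtain ⟨a, rfl⟩ := hf
    obtain ⟨b, rfl⟩ := hg
    exact ⟨a + b, smul_add _ _ _⟩
  | single i v =>
    obtain ⟨w, rfl⟩ := hV n hn v
    exact ⟨Finsupp.single i w, Finsupp.smul_single _ _ _⟩

theorem isDenseDivisible_ker_lexSum {V : Type u} [AddCommGroup V] [LinearOrder V]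
    [IsOrderedAddMonoid V] [Nontrivial V] (hV : IsDivisible V) :
    IsDenseDivisible (lexSum V).ker := by
  refine ⟨hV.lex_finsupp, fun n hn q hq => ?_, fun a b hab => ?_⟩
  · obtain ⟨r, rfl⟩ := hV.lex_finsupp n hn q
    refine ⟨r, ?_, rfl⟩
    rw [AddMonoidHom.mem_ker, map_nsmul] at hq
    rw [AddMonoidHom.mem_ker]
    exact nsmul_right_injective hn (hq.trans (smul_zero n).symm)
  · obtain ⟨i, hi, hi'⟩ := Finsupp.Lex.lt_iff.1 hab
    obtain ⟨v, hv⟩ := exists_gt (0 : V)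
    -- `a` and `b` first differ at `i`. Changes after `i` keep `q` below `b`; adding `v` at `i + 1`
    -- puts `q` above `a`, and the entry at `i + 2` makes the sum zero.
    let q : Lex (ℕ →₀ V) := a + lexSingle (i + 1) v + lexSingle (i + 2) (- v - lexSum V a)
    have hlow : ∀ j ≤ i, ofLex q j = ofLex a j := by
      intro j hj
      change ofLex a j + (Finsupp.single (i + 1) v : ℕ →₀ V) j +
        (Finsupp.single (i + 2) (- v - lexSum V a) : ℕ →₀ V) j = ofLex a j
      rw [Finsupp.single_eq_of_ne (by omega), Finsupp.single_eq_of_ne (by omega), add_zero, add_zero]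
    have hq : ofLex q (i + 1) = ofLex a (i + 1) + v := by
      change ofLex a (i + 1) + (Finsupp.single (i + 1) v : ℕ →₀ V) (i + 1) +
        (Finsupp.single (i + 2) (- v - lexSum V a) : ℕ →₀ V) (i + 1) = _
      rw [Finsupp.single_eq_same, Finsupp.single_eq_of_ne (by omega), add_zero]
    refine ⟨q, ?_, Finsupp.Lex.lt_iff.2 ⟨i + 1, fun j hj => (hlow j (by omega)).symm, ?_⟩,
      Finsupp.Lex.lt_iff.2 ⟨i, fun j hj => (hlow j hj.le).trans (hi j hj), ?_⟩⟩
    · rw [AddMonoidHom.mem_ker, map_add, map_add, lexSum_lexSingle, lexSum_lexSingle]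
      abel
    · rw [hq]
      exact lt_add_of_pos_right _ hv
    · rwa [hlow i le_rfl]

/-- There are divisible ordered abelian groups of any infinite cardinality with a dense divisible
subgroup that has a complement of the same cardinality. -/
theorem exists_dense_subgroup_with_complement (β : Cardinal.{u}) (hβ : ℵ₀ ≤ β) :
    ∃ (G : Type u) (_ : AddCommGroup G) (_ : LinearOrder G) (_ : IsOrderedAddMonoid G)
      (_ : Nontrivial G) (Q H : AddSubgroup G), #G = β ∧ #H = β ∧ IsDenseDivisible Q ∧
        (∀ n : ℕ, n ≠ 0 → ∀ q ∈ H, ∃ r ∈ H, n • r = q) ∧ (∀ x ∈ Q, x ∈ H → x = 0) ∧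
        (∀ g : G, ∃ q ∈ Q, ∃ h ∈ H, q + h = g) ∧ ∃ h ∈ H, h ≠ 0 := by
  let I := β.ord.ToType
  have hI : #I = β := mk_ord_toType β
  have : Infinite I := infinite_iff.2 (hI ▸ hβ)
  let V := Lex (I →₀ ℚ)
  have hVcard : #V = β := by
    have : #(I →₀ ℚ) = β := by
      rw [mk_finsupp_lift_of_infinite, hI, mk_eq_aleph0, lift_aleph0, lift_uzero]
      exact max_eq_left hβ
    exact this
  have hinfV : Infinite V := infinite_iff.2 (hVcard ▸ hβ)
  have hV : IsDivisible V := IsDivisible.lex_finsupp fun n hn q =>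
    ⟨q / n, by rw [nsmul_eq_mul]; field_simp⟩
  have hGcard : #(Lex (ℕ →₀ V)) = β := by
    have : #(ℕ →₀ V) = β := by
      rw [mk_finsupp_lift_of_infinite, hVcard, mk_eq_aleph0, lift_aleph0, lift_uzero]
      exact max_eq_right hβ
    exact this
  have hinj : Function.Injective (lexSingle 0 : V →+ Lex (ℕ →₀ V)) :=
    Finsupp.single_injective 0
  have hinfG : Infinite (Lex (ℕ →₀ V)) := infinite_iff.2 (hGcard ▸ hβ)
  refine ⟨Lex (ℕ →₀ V), inferInstance, inferInstance, inferInstance, inferInstance,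
    (lexSum V).ker, (lexSingle 0 : V →+ _).range, hGcard, ?_, isDenseDivisible_ker_lexSum hV,
    ?_, ?_, ?_, ?_⟩
  · rw [← hVcard]
    exact mk_range_eq _ hinj
  · rintro n hn _ ⟨v, rfl⟩
    obtain ⟨w, rfl⟩ := hV n hn v
    exact ⟨_, ⟨w, rfl⟩, (map_nsmul _ _ _).symm⟩
  · rintro _ hx ⟨v, rfl⟩
    rw [AddMonoidHom.mem_ker, lexSum_lexSingle] at hx
    rw [hx, map_zero]
  · intro g
    refine ⟨g - lexSingle 0 (lexSum V g), ?_, _, ⟨lexSum V g, rfl⟩, sub_add_cancel _ _⟩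
    rw [AddMonoidHom.mem_ker, map_sub, lexSum_lexSingle, sub_self]
  · obtain ⟨v, hv⟩ := exists_ne (0 : V)
    exact ⟨_, ⟨v, rfl⟩, fun h => hv (hinj (h.trans (map_zero _).symm))⟩

end DenseSubgroup

/-! ### Cardinalities and Dedekind cuts -/

section Cardinality

open FullPower

theorem le_powerlt_self {β lam : Cardinal.{u}} (hβ : 2 ≤ β) : lam ≤ β ^< lam := by
  refine le_of_forall_lt fun c hc => ?_
  exact (cantor c).trans_le ((power_le_power_right hβ).trans (le_powerlt β hc))

variable {lam : Cardinal.{u}} {G : Type u} [AddCommGroup G]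

theorem mk_fullPower : #(FullPower lam G) = #G ^ lam := by
  change #(lam.ord.ToType → G) = _
  simp

/-- A sequence is determined by a bound on its support and its restriction below that bound, which
leaves at most `λ * |G|^{<λ} = |G|^{<λ}` sequences. Conversely, for `c < λ`, functions on the
initial segment of size `c` extend by zero. -/
theorem mk_boundedPower [Nontrivial G] (hlam : ℵ₀ ≤ lam) :
    #(boundedPower lam G hlam) = #G ^< lam := by
  have h2 : 2 ≤ #G := two_le_iff.2 (exists_pair_ne G)
  apply le_antisymm
  · choose b hb using fun x : boundedPower lam G hlam => x.2
    have hinj : Function.Injective fun x : boundedPower lam G hlam =>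
        (⟨b x, fun j => ofLex (x : FullPower lam G) j⟩ : Σ i : lam.ord.ToType, Set.Iio i → G) := by
      intro x y hxy
      obtain ⟨h₁, h₂⟩ := Sigma.mk.inj_iff.1 hxy
      refine Subtype.ext (funext fun j => ?_)
      rcases lt_or_ge j (b x) with hj | hj
      -- The bound is generalized to `i` in order to eliminate the heterogeneous equality.
      · have key : ∀ (i : lam.ord.ToType) (p : Set.Iio i → G), b x = i →
            HEq (fun j : Set.Iio (b x) => ofLex (x : FullPower lam G) j) p →
            ∀ h : j < i, ofLex (x : FullPower lam G) j = p ⟨j, h⟩ := by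
          rintro i p rfl h _
          exact congrFun (eq_of_heq h) ⟨j, hj⟩
        exact key _ _ h₁ h₂ (h₁ ▸ hj)
      · exact (hb x j hj).trans (hb y j (h₁ ▸ hj)).symm
    calc #(boundedPower lam G hlam) ≤ #(Σ i : lam.ord.ToType, Set.Iio i → G) :=
          mk_le_of_injective hinj
      _ = sum fun i : lam.ord.ToType => #G ^ #(Set.Iio i) := by rw [mk_sigma]; simp
      _ ≤ sum fun _ : lam.ord.ToType => #G ^< lam := by
          refine sum_le_sum _ _ fun i => le_powerlt _ ?_
          simpa using mk_Iio_lt i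
      _ = lam * #G ^< lam := by simp
      _ ≤ #G ^< lam * #G ^< lam := mul_le_mul_left (le_powerlt_self h2) _
      _ = #G ^< lam := mul_eq_self (hlam.trans (le_powerlt_self h2))
  · refine powerlt_le.2 fun c hc => ?_
    have hlt : c.ord < Ordinal.type (α := lam.ord.ToType) (· < ·) := by
      rw [Ordinal.type_toType]
      exact ord_lt_ord.2 hc
    let i : lam.ord.ToType := Ordinal.enum (α := lam.ord.ToType) (· < ·) ⟨c.ord, hlt⟩
    have hi : #(Set.Iio i) = c := by
      have := Ordinal.card_typein (r := ((· < ·) : lam.ord.ToType → _ → Prop)) i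
      rw [Ordinal.typein_enum, card_ord] at this
      exact this.symm
    have : #G ^ c = #(Set.Iio i → G) := by rw [← hi]; simp
    rw [this]
    classical
    refine mk_le_of_injective (f := fun p : Set.Iio i → G =>
      (⟨toLex fun j => if h : j < i then p ⟨j, h⟩ else 0, i, fun j hj => dif_neg hj.not_gt⟩ :
        boundedPower lam G hlam)) fun p q hpq => ?_
    ext ⟨j, hj⟩
    have := congrFun (congrArg Subtype.val hpq) j
    change (if h : j < i then p ⟨j, h⟩ else 0) = if h : j < i then q ⟨j, h⟩ else 0 at this
    have hji : j < i := hj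
    exact (dif_pos hji).symm.trans (this.trans (dif_pos hji))

theorem power_le_mk_eventuallyIn [LinearOrder G] [IsOrderedAddMonoid G] (hlam : ℵ₀ ≤ lam)
    (H : AddSubgroup G) : #H ^ lam ≤ #(eventuallyIn hlam H) := by
  obtain ⟨i, -⟩ := (boundedPower lam G hlam).zero_mem
  have : #H ^ lam = #(lam.ord.ToType → H) := by simp
  rw [this]
  refine mk_le_of_injective (f := fun p : lam.ord.ToType → H =>
    (⟨toLex fun j => p j, i, fun j _ => (p j).2⟩ : eventuallyIn hlam H)) fun p q hpq => ?_
  ext j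
  exact congrFun (congrArg Subtype.val hpq) j

/-- Each point of `X` cuts `P`, and density makes this a Dedekind cut and separates distinct points.
-/
theorem mk_le_mk_dedekindCut {P X : Type u} [LinearOrder P] [LinearOrder X] (e : P ↪o X)
    (he : ∀ a b : X, a < b → ∃ p, a < e p ∧ e p < b) : #X ≤ #(DedekindCut P) := by
  let cut : X → DedekindCut P := fun a =>
    { extent := {p | e p ≤ a}
      intent := {p | a ≤ e p}
      upperPolar_extent := by
        ext p
        refine ⟨fun h => ?_, fun h q hq => e.le_iff_le.1 (le_trans hq h)⟩
        change a ≤ e p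
        by_contra! hc
        obtain ⟨q, hq, hq'⟩ := he _ _ hc
        exact absurd (e.le_iff_le.2 (h hq'.le)) (not_le.2 hq)
      lowerPolar_intent := by
        ext p
        refine ⟨fun h => ?_, fun h q hq => e.le_iff_le.1 (le_trans h hq)⟩
        change e p ≤ a
        by_contra! hc
        obtain ⟨q, hq, hq'⟩ := he _ _ hc
        exact absurd (e.le_iff_le.2 (h hq.le)) (not_le.2 hq') }
  have key : ∀ a b, cut a = cut b → ¬ a < b := by
    intro a b hab hlt
    obtain ⟨p, hp, hp'⟩ := he a b hlt
    have : p ∈ (cut a).left := by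
      rw [hab]
      exact hp'.le
    exact absurd hp (not_lt.2 this)
  exact mk_le_of_injective fun a b hab =>
    le_antisymm (not_lt.1 (key b a hab.symm)) (not_lt.1 (key a b hab))

theorem mk_dedekindCut_le_ded {α : Cardinal.{u}} {P : Type u} [LinearOrder P] (hP : #P ≤ α) :
    #(DedekindCut P) ≤ Ded α :=
  le_csSup (bddAbove_ded α) ⟨P, _, hP, rfl⟩

theorem ded_le_two_power (α : Cardinal.{u}) : Ded α ≤ 2 ^ α := by
  refine csSup_le ⟨_, PEmpty, inferInstance, by simp, rfl⟩ ?_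
  rintro c ⟨P, _, hP, rfl⟩
  calc #(DedekindCut P) ≤ #(Set P) :=
        mk_le_of_injective (f := fun A : DedekindCut P => A.left) fun _ _ h => DedekindCut.ext h
    _ = 2 ^ #P := mk_set
    _ ≤ 2 ^ α := power_le_power_left two_ne_zero hP

theorem mk_fullPower_le_ded [LinearOrder G] [IsOrderedAddMonoid G] (hlam : ℵ₀ ≤ lam)
    (hG : IsDivisible G) :
    #(FullPower lam G) ≤ Ded #(boundedPower lam G hlam) := by
  have := hG.denselyOrdered
  refine (mk_le_mk_dedekindCut (P := boundedPower lam G hlam)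
    (OrderEmbedding.subtype _) fun a b hab => ?_).trans (mk_dedekindCut_le_ded le_rfl)
  obtain ⟨i, hi, hi'⟩ := lt_iff.1 hab
  obtain ⟨g, hg, hg'⟩ := exists_between hi'
  -- Replacing the first component where `a` and `b` differ by an intermediate value, then
  -- truncating there, gives an element of `G^{<λ}` strictly between them.
  let x : FullPower lam G := toLex fun j => if j = i then g else coord j a
  have hx : coord i x = g := if_pos rfl
  have hx' : ∀ j < i, coord j x = coord j a := fun j hj => if_neg hj.ne
  refine ⟨trunc hlam i x, lt_iff.2 ⟨i, fun j hj => ?_, ?_⟩, lt_iff.2 ⟨i, fun j hj => ?_, ?_⟩⟩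
  · exact ((if_pos hj.le).trans (hx' j hj)).symm
  · exact hg.trans_eq (((if_pos le_rfl).trans hx).symm)
  · exact ((if_pos hj.le).trans (hx' j hj)).trans (hi j hj)
  · exact ((if_pos le_rfl).trans hx).trans_lt hg'

theorem two_le_of_aleph0_le_powerlt {β lam : Cardinal.{u}} (h : ℵ₀ ≤ β ^< lam) : 2 ≤ β := by
  by_contra! hc
  have h1 : β ≤ 1 := by
    obtain ⟨n, rfl⟩ := lt_aleph0.1 (hc.trans (natCast_lt_aleph0 (n := 2)))
    norm_cast at hc ⊢
    omega
  have : β ^< lam ≤ 1 := powerlt_le.2 fun c _ => (power_le_power_right h1).trans (one_power).le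
  exact absurd (h.trans this) (not_le.2 one_lt_aleph0)

theorem max_aleph0_power {β c : Cardinal.{u}} (hβ : 2 ≤ β) (hc : ℵ₀ ≤ c) :
    max β ℵ₀ ^ c = β ^ c := by
  rcases le_total ℵ₀ β with h | h
  · rw [max_eq_left h]
  · rw [max_eq_right h, power_eq_two_power hc (natCast_le_aleph0 (n := 2)) hc,
      power_eq_two_power hc hβ (h.trans hc)]

/-- `β` may be finite but `G` must be infinite; enlarging `β` to `max β ℵ₀` is harmless, since
finite powers of `ℵ₀` are at most `ℵ₀` and infinite exponents absorb the change. -/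
theorem max_aleph0_powerlt {β lam : Cardinal.{u}} (h : ℵ₀ ≤ β ^< lam) :
    max β ℵ₀ ^< lam = β ^< lam := by
  have hβ := two_le_of_aleph0_le_powerlt h
  apply le_antisymm
  · refine powerlt_le.2 fun c hc => ?_
    rcases lt_or_ge c ℵ₀ with h0 | h0
    · rcases le_total ℵ₀ β with hb | hb
      · rw [max_eq_left hb]
        exact le_powerlt β hc
      · rw [max_eq_right hb]
        obtain ⟨n, rfl⟩ := lt_aleph0.1 h0
        exact (power_nat_le le_rfl).trans h
    · rw [max_aleph0_power hβ h0]
      exact le_powerlt β hc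
  · exact powerlt_le.2 fun c hc => (power_le_power_right (le_max_left _ _)).trans (le_powerlt _ hc)

end Cardinality

/-- The group `G^{<λ}` with `|G| = β` has a maximal small extension of cardinality `β^λ`. -/
theorem exists_isMaximalSmallExtension {β lam : Cardinal.{u}} (hlam : ℵ₀ ≤ lam)
    (h : ℵ₀ ≤ β ^< lam) :
    ∃ (G : Type u) (_ : AddCommGroup G) (_ : LinearOrder G) (_ : IsOrderedAddMonoid G)
        (Q : AddSubgroup G),
      IsDenseDivisible Q ∧
      #(boundedPower lam G hlam) = β ^< lam ∧
      OMinimal (constLang lam hlam Q) (boundedPower lam G hlam) ∧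
      (∃ (N : Type u) (_ : (constLang lam hlam Q).Structure N)
        (f : boundedPower lam G hlam ↪ₑ[constLang lam hlam Q] N),
        IsMaximalSmallExtension.{u, v} f ∧ #N = β ^ lam) ∧
      β ^ lam ≤ Ded (β ^< lam) := by
  obtain ⟨G, _, _, _, _, Q, H, hG, hHcard, hQ, hH, hQH, hsum, hH0⟩ :=
    exists_dense_subgroup_with_complement (max β ℵ₀) (le_max_right _ _)
  have hfull : #(FullPower lam G) = β ^ lam := by
    rw [mk_fullPower, hG, max_aleph0_power (two_le_of_aleph0_le_powerlt h) hlam]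
  have hbounded : #(boundedPower lam G hlam) = β ^< lam := by
    rw [mk_boundedPower, hG, max_aleph0_powerlt h]
  have hle : #(FullPower lam G) ≤ #(eventuallyIn hlam H) := by
    rw [mk_fullPower, hG, ← hHcard]
    exact power_le_mk_eventuallyIn hlam H
  have := nontrivial_boundedPower (G := G) hlam
  refine ⟨G, _, _, inferInstance, Q, hQ, hbounded, (IsDivisible.boundedPower hlam hQ.1).oMinimal,
    ⟨eventuallyIn hlam H, inferInstance, boundedPowerEmbedding hlam hQ.1 hH,
      isMaximalSmallExtension_boundedPowerEmbedding hQ hH hQH hsum hH0 hle,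
      (le_antisymm (mk_set_le _) hle).trans hfull⟩, ?_⟩
  rw [← hfull, ← hbounded]
  exact mk_fullPower_le_ded hlam hQ.1

theorem mainTheorem1 (α : Cardinal.{u}) (hα : ℵ₀ ≤ α) :
    -- an o-minimal structure of size `α` with a maximal small extension
    (∃ (lam : Cardinal.{u}) (hlam : ℵ₀ ≤ lam) (G : Type u) (_ : AddCommGroup G)
        (_ : LinearOrder G) (_ : IsOrderedAddMonoid G) (Q : AddSubgroup G),
      IsDenseDivisible Q ∧
      #(boundedPower lam G hlam) = α ∧
      OMinimal (constLang lam hlam Q) (boundedPower lam G hlam) ∧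
      ∃ (N : Type u) (_ : (constLang lam hlam Q).Structure N)
        (f : boundedPower lam G hlam ↪ₑ[constLang lam hlam Q] N),
        IsMaximalSmallExtension.{u, v} f ∧
        (α = ℵ₀ → #N = 2 ^ ℵ₀ ∧ #N = Ded α)) ∧
    -- the size of the maximal small extension when `α = β^{<λ}`
    (∀ (β lam : Cardinal.{u}) (hlam : ℵ₀ ≤ lam), α = β ^< lam →
      (∃ (G : Type u) (_ : AddCommGroup G) (_ : LinearOrder G) (_ : IsOrderedAddMonoid G)
          (Q : AddSubgroup G),
        IsDenseDivisible Q ∧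
        #(boundedPower lam G hlam) = α ∧
        OMinimal (constLang lam hlam Q) (boundedPower lam G hlam) ∧
        ∃ (N : Type u) (_ : (constLang lam hlam Q).Structure N)
          (f : boundedPower lam G hlam ↪ₑ[constLang lam hlam Q] N),
          IsMaximalSmallExtension.{u, v} f ∧ #N = β ^ lam) ∧
      β ^ lam ≤ Ded α ∧
      (2 ^ α ≤ β ^ lam → β ^ lam = Ded α) ∧
      (lam = α → β ^ lam = Ded α)) := by

  have key : ∀ (β lam : Cardinal.{u}), ℵ₀ ≤ lam → α = β ^< lam →
      β ^ lam ≤ Ded α ∧ (2 ^ α ≤ β ^ lam → β ^ lam = Ded α) ∧ (lam = α → β ^ lam = Ded α) := by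
    intro β lam hlam hαβ
    have h : ℵ₀ ≤ β ^< lam := hαβ ▸ hα
    have hle : β ^ lam ≤ Ded α := by
      obtain ⟨_, _, _, _, _, _, _, _, _, hd⟩ := exists_isMaximalSmallExtension.{u, v} hlam h
      exact hαβ ▸ hd
    have heq : 2 ^ α ≤ β ^ lam → β ^ lam = Ded α := fun h2 =>
      le_antisymm hle ((ded_le_two_power α).trans h2)
    -- When `λ = α`, the bound `2 ^ α ≤ β ^ λ` follows from `2 ≤ β`.
    exact ⟨hle, heq, fun hl => heq (hl ▸ power_le_power_right (two_le_of_aleph0_le_powerlt h))⟩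
  constructor
  -- Every infinite `α` equals `α^{<ℵ₀}`, so `λ = ℵ₀` and `β = α` always work; for `α = ℵ₀` this is
  -- also the case `λ = α`.
  · have hα' : α ^< ℵ₀ = α := powerlt_aleph0 hα
    obtain ⟨G, _, _, _, Q, hQ, hM, ho, ⟨N, _, f, hf, hN⟩, -⟩ :=
      exists_isMaximalSmallExtension.{u, v} (β := α) le_rfl (hα'.symm ▸ hα)
    refine ⟨ℵ₀, le_rfl, G, _, _, inferInstance, Q, hQ, hM.trans hα', ho, N, _, f, hf, ?_⟩
    intro h0
    exact ⟨by rw [hN, h0, power_self_eq le_rfl],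
      hN.trans ((key α ℵ₀ le_rfl hα'.symm).2.2 h0.symm)⟩
  · intro β lam hlam hαβ
    obtain ⟨G, _, _, _, Q, hQ, hM, ho, hN, -⟩ :=
      exists_isMaximalSmallExtension.{u, v} hlam (hαβ ▸ hα : ℵ₀ ≤ β ^< lam)
    exact ⟨⟨G, _, _, inferInstance, Q, hQ, hM.trans hαβ.symm, ho, hN⟩, key β lam hlam hαβ⟩
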